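/- Let $G=(V,E)$ be a finite loopless multigraph (parallel edges allowed) of maximum degree $\Delta$, and let $t$ be an integer with $\left\lfloor \frac{3\Delta}{2}\right\rfloor \ge t\ge \left(\frac12\sqrt{22}-1\right)\Delta$. Assume that no subgraph of $G$ with exactly three vertices has more than $t$ edges. Then $G$ has a subgraph $H$ with at least $\frac{\Delta}{t}|E|$ edges that is $\Delta$-edge-colorable, i.e. the edges of $H$ can be assigned colors from $\{1,\dots,\Delta\}$ so that any two distinct edges of $H$ with a common endpoint receive different colors. (If $\Delta=0$, then $E=\emptyset$ and the bound is read as $0$.) Moreover, there is an algorithm which, given such a multigraph $G$ (as a list of its vertices and of the endpoints of its edges) and such a $t$, finds such a subgraph $H$ together with such a coloring of it in time polynomial in $|V|+|E|$. -/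

import Mathlib

open scoped Graph

universe u v

/-! ## Multigraphs: degree and edge coloring

Multigraphs are Mathlib's `Graph α β`, with vertex set `V(G) : Set α`, edge set `E(G) : Set β`,
possibly parallel edges, and subgraph relation `H ≤ G`. -/

namespace Graph

/-- The degree of a vertex: the number of incident edges, loops counted twice. -/
noncomputable def degree {α : Type u} {β : Type v} (G : Graph α β) (x : α) : ℕ :=
  (G.incidenceSet x).ncard + (G.loopSet x).ncard

/-- The maximum degree of a finite multigraph (`0` if there are no vertices). -/
noncomputable def maxDegree {α : Type u} {β : Type v} (G : Graph α β) : ℕ :=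
  ⨆ x : V(G), G.degree x

/-- `c` assigns to the edges of `H` colors from `{1, …, k}` so that any two distinct incident edges
receive different colors. (The values of `c` outside `E(H)` are irrelevant.) -/
def IsEdgeColoring {α : Type u} {β : Type v} (H : Graph α β) (k : ℕ) (c : β → ℕ) : Prop :=
  (∀ e ∈ E(H), 1 ≤ c e ∧ c e ≤ k) ∧
  ∀ e ∈ E(H), ∀ f ∈ E(H), e ≠ f → (∃ x, H.Inc e x ∧ H.Inc f x) → c e ≠ c f

/-- `H` is `k`-edge-colorable. -/
def EdgeColorable {α : Type u} {β : Type v} (H : Graph α β) (k : ℕ) : Prop :=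
  ∃ c : β → ℕ, H.IsEdgeColoring k c

end Graph

/-! ## A random access machine with a step count

Programs are while-programs over finitely many registers and finitely many arrays of natural
numbers, with unit cost for each operation. There is no multiplication: addition is the only
operation that can increase a number, so in `T` steps the bit length grows by `O(T)` only, and the
unit-cost measure is polynomially equivalent to the running time of a Turing machine. -/

namespace RAM

/-- The memory: registers `reg i`, and arrays `arr a` with cells `arr a j`. -/
structure Store where
  reg : ℕ → ℕ
  arr : ℕ → ℕ → ℕ

/-- Expressions. `lt` and `eq` are comparisons with value `1` (true) or `0` (false), and `sub` is
truncated subtraction. -/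
inductive Expr where
  | lit (c : ℕ)
  | reg (i : ℕ)
  | get (a : ℕ) (j : Expr)
  | add (e f : Expr)
  | sub (e f : Expr)
  | lt (e f : Expr)
  | eq (e f : Expr)

/-- The value of an expression. -/
def Expr.eval (s : Store) : Expr → ℕ
  | .lit c => c
  | .reg i => s.reg i
  | .get a j => s.arr a (j.eval s)
  | .add e f => e.eval s + f.eval s
  | .sub e f => e.eval s - f.eval s
  | .lt e f => if e.eval s < f.eval s then 1 else 0
  | .eq e f => if e.eval s = f.eval s then 1 else 0

/-- The cost of evaluating an expression: one step for each constant, register access, array access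
and operation in it. -/
def Expr.cost : Expr → ℕ
  | .lit _ => 1
  | .reg _ => 1
  | .get _ j => j.cost + 1
  | .add e f => e.cost + f.cost + 1
  | .sub e f => e.cost + f.cost + 1
  | .lt e f => e.cost + f.cost + 1
  | .eq e f => e.cost + f.cost + 1

/-- Programs. The guard `e` of `ite` and `loop` is true if its value is not `0`. -/
inductive Prog where
  | skip
  | set (i : ℕ) (e : Expr)
  | put (a : ℕ) (j e : Expr)
  | seq (p q : Prog)
  | ite (e : Expr) (p q : Prog)
  | loop (e : Expr) (p : Prog)

/-- Assign the value `x` to register `i`. -/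
def Store.setReg (s : Store) (i x : ℕ) : Store :=
  { s with reg := Function.update s.reg i x }

/-- Assign the value `x` to cell `j` of array `a`. -/
def Store.setArr (s : Store) (a j x : ℕ) : Store :=
  { s with arr := Function.update s.arr a (Function.update (s.arr a) j x) }

/-- `p.Runs s T s'`: started in the memory `s`, the program `p` halts after exactly `T` steps, in the
memory `s'`. -/
inductive Prog.Runs : Prog → Store → ℕ → Store → Prop where
  | skip (s : Store) : Runs .skip s 1 s
  | set (s : Store) (i : ℕ) (e : Expr) :
      Runs (.set i e) s (e.cost + 1) (s.setReg i (e.eval s))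
  | put (s : Store) (a : ℕ) (j e : Expr) :
      Runs (.put a j e) s (j.cost + e.cost + 1) (s.setArr a (j.eval s) (e.eval s))
  | seq {p q : Prog} {s s' s'' : Store} {T T' : ℕ} :
      Runs p s T s' → Runs q s' T' s'' → Runs (.seq p q) s (T + T') s''
  | iteTrue {e : Expr} {p q : Prog} {s s' : Store} {T : ℕ} :
      e.eval s ≠ 0 → Runs p s T s' → Runs (.ite e p q) s (e.cost + 1 + T) s'
  | iteFalse {e : Expr} {p q : Prog} {s s' : Store} {T : ℕ} :
      e.eval s = 0 → Runs q s T s' → Runs (.ite e p q) s (e.cost + 1 + T) s'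
  | loopDone {e : Expr} {p : Prog} {s : Store} :
      e.eval s = 0 → Runs (.loop e p) s (e.cost + 1) s
  | loopStep {e : Expr} {p : Prog} {s s' s'' : Store} {T T' : ℕ} :
      e.eval s ≠ 0 → Runs p s T s' → Runs (.loop e p) s' T' s'' →
      Runs (.loop e p) s (e.cost + 1 + T + T') s''

/-- The machine is deterministic: a program has at most one halting run from a given memory. -/
theorem Prog.Runs.unique {p : Prog} {s s₁ : Store} {T₁ : ℕ} (h : p.Runs s T₁ s₁) :
    ∀ {T₂ : ℕ} {s₂ : Store}, p.Runs s T₂ s₂ → T₁ = T₂ ∧ s₁ = s₂ := by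
  induction h with
  | skip s => intro _ _ h; cases h; exact ⟨rfl, rfl⟩
  | set s i e => intro _ _ h; cases h; exact ⟨rfl, rfl⟩
  | put s a j e => intro _ _ h; cases h; exact ⟨rfl, rfl⟩
  | seq _ _ ih₁ ih₂ =>
    intro _ _ h
    cases h with
    | seq h₁ h₂ =>
      obtain ⟨rfl, rfl⟩ := ih₁ h₁
      obtain ⟨rfl, rfl⟩ := ih₂ h₂
      exact ⟨rfl, rfl⟩
  | iteTrue he _ ih =>
    intro _ _ h
    cases h with
    | iteTrue _ h₁ => obtain ⟨rfl, rfl⟩ := ih h₁; exact ⟨rfl, rfl⟩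
    | iteFalse he' _ => exact absurd he' he
  | iteFalse he _ ih =>
    intro _ _ h
    cases h with
    | iteTrue he' _ => exact absurd he he'
    | iteFalse _ h₁ => obtain ⟨rfl, rfl⟩ := ih h₁; exact ⟨rfl, rfl⟩
  | loopDone he =>
    intro _ _ h
    cases h with
    | loopDone _ => exact ⟨rfl, rfl⟩
    | loopStep he' _ _ => exact absurd he he'
  | loopStep he _ _ ih₁ ih₂ =>
    intro _ _ h
    cases h with
    | loopDone he' => exact absurd he' he
    | loopStep _ h₁ h₂ =>
      obtain ⟨rfl, rfl⟩ := ih₁ h₁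
      obtain ⟨rfl, rfl⟩ := ih₂ h₂
      exact ⟨rfl, rfl⟩

/-- The initial memory for the input consisting of a multigraph with vertices `0, …, n - 1` and edges
`0, …, m - 1`, where edge `e` joins `a e` and `b e`, and of a natural number `t`: registers `0`, `1`,
`2` hold `n`, `m`, `t`, arrays `0` and `1` list the ends of the edges, and everything else is `0`. -/
def input (n m : ℕ) (a b : ℕ → ℕ) (t : ℕ) : Store where
  reg i := if i = 0 then n else if i = 1 then m else if i = 2 then t else 0
  arr k e := if e < m then (if k = 0 then a e else if k = 1 then b e else 0) else 0

/-- The output of a halted program is array `2`: the color of each edge, `0` for an edge that does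
not belong to the subgraph found. -/
def Store.output (s : Store) (e : ℕ) : ℕ := s.arr 2 e

end RAM

/-! ## The hypotheses on the multigraph and the parameter -/

/-- `G` is a finite loopless multigraph, `t` is an integer with
`⌊3Δ/2⌋ ≥ t ≥ (√22/2 - 1)Δ`, where `Δ` is the maximum degree of `G`, and no three-vertex subgraph
of `G` has more than `t` edges. -/
structure IsInstance {α : Type u} {β : Type v} (G : Graph α β) (t : ℤ) : Prop where
  finite_vertexSet : V(G).Finite
  finite_edgeSet : E(G).Finite
  loopless : G.Loopless
  le_floor : t ≤ ⌊(3 * (G.maxDegree : ℝ)) / 2⌋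
  ge_mul : (Real.sqrt 22 / 2 - 1) * (G.maxDegree : ℝ) ≤ (t : ℝ)
  three_vertex : ∀ H : Graph α β, H ≤ G → V(H).ncard = 3 → ¬ (t < (E(H).ncard : ℤ))

/-! Write `Δ` for the maximum degree. The core is that `G` is `t`-edge-colorable. Given a
`t`-coloring of all edges, smallest color classes are deleted one by one until `Δ` colors remain.
Dropping the smallest of `k + 1` classes keeps at least the fraction `k / (k + 1)` of the colored
edges, so at least `Δ / t` of all edges survive. The lower bound on `t` enters only through its
consequence `4Δ ≤ 3t`.

For the coloring, let a partial proper coloring leave the edge `e = xy` uncolored, and suppose that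
no few recolorings and Kempe exchanges lead to more colored edges. Kempe chains make the sets of
colors free at `x`, at `y` and at the leaves of a fan disjoint, up to coincidences among leaves. By
`4Δ ≤ 3t` there is no room for four disjoint sets when two of them belong to the ends of an
uncolored edge (`exists_common_free`). Hence each fan has one leaf (`fan_unique`), and the fans at
`x` and at `y` share it. This gives a closed triple `x, y, z`: every color free at one of the three
vertices is carried by an edge joining the other two (`exists_isClosedTriple`).

Every other color also has an edge inside the triple. Otherwise one or two exchanges make it free at
`z` or at one of `x`, `y` while preserving the closed triple, and a closed triple would then require
an edge of this color inside (`colorLink_inside`). So the triple contains an edge of each of the `t`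
colors as well as the uncolored `e`. These are `t + 1` edges on three vertices, which the hypothesis
forbids.

The argument yields an improvement within eight steps, each given by five parameters of polynomial
range (`IsPartialColoring.improvable`). The algorithm therefore need not follow the proof: it tries
all sequences of eight steps and keeps any better proper coloring found. As many rounds as there are
edges color everything. Its loops have bounds fixed by the input, which makes the polynomial running
time a matter of structural recursion. -/

/-! ## Alternating paths -/

/-- `AltPath R S p k u`: there is an alternating path of length `k` from `p` to `u` along two
relations, beginning with `R`. -/
def AltPath {V : Type*} (R S : V → V → Prop) (p : V) : ℕ → V → Prop
  | 0, u => u = p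
  | k + 1, u => ∃ w, AltPath R S p k w ∧ if Even k then R w u else S w u

namespace AltPath

variable {V : Type*} {R S : V → V → Prop} {p : V}

theorem unique (hR : ∀ u w w', R u w → R u w' → w = w') (hS : ∀ u w w', S u w → S u w' → w = w') :
    ∀ {k : ℕ} {u u' : V}, AltPath R S p k u → AltPath R S p k u' → u = u'
  | 0, _, _, h, h' => h.trans h'.symm
  | k + 1, u, u', ⟨w, hw, h⟩, ⟨w', hw', h'⟩ => by
    obtain rfl := unique hR hS hw hw'
    split_ifs at h h'
    · exact hR _ _ _ h h'
    · exact hS _ _ _ h h'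

theorem exists_prefix {j : ℕ} : ∀ {k : ℕ} {u : V}, AltPath R S p k u → j ≤ k → ∃ w, AltPath R S p j w
  | 0, u, h, hj => by obtain rfl := Nat.le_zero.1 hj; exact ⟨u, h⟩
  | k + 1, u, h, hj => by
    rcases hj.eq_or_lt with rfl | hj
    · exact ⟨u, h⟩
    · obtain ⟨w, hw, -⟩ := h
      exact exists_prefix hw (Nat.lt_succ_iff.1 hj)

/-- From an endpoint missed by `S` a walk has no choice: each further link either continues the
alternation or, the relations being symmetric and single-valued, retraces the last link and leaves a
shorter alternating path. -/
theorem of_reflTransGen (hR : ∀ u w w', R u w → R u w' → w = w')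
    (hS : ∀ u w w', S u w → S u w' → w = w') (hR' : ∀ u w, R u w → R w u)
    (hS' : ∀ u w, S u w → S w u) (hp : ∀ w, ¬ S p w) {u : V}
    (h : Relation.ReflTransGen (fun u w => R u w ∨ S u w) p u) : ∃ k, AltPath R S p k u := by
  induction h with
  | refl => exact ⟨0, rfl⟩
  | @tail u w _ huw ih =>
    obtain ⟨k, hk⟩ := ih
    by_cases he : Even k
    · rcases huw with huw | huw
      · exact ⟨k + 1, u, hk, by rwa [if_pos he]⟩
      · match k, hk with
        | 0, hk => obtain rfl : u = p := hk; exact absurd huw (hp w)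
        | j + 1, ⟨w', hw', h'⟩ =>
          rw [if_neg (fun h => by simp [Nat.even_add_one, h] at he)] at h'
          obtain rfl := hS _ _ _ huw (hS' _ _ h')
          exact ⟨j, hw'⟩
    · rcases huw with huw | huw
      · match k, hk with
        | 0, hk => simp at he
        | j + 1, ⟨w', hw', h'⟩ =>
          rw [if_pos (by simpa [Nat.even_add_one] using he)] at h'
          obtain rfl := hR _ _ _ huw (hR' _ _ h')
          exact ⟨j, hw'⟩
      · exact ⟨k + 1, u, hk, by rwa [if_neg he]⟩

/-- A path that enters `q` along one relation can leave it only along the other. Since `q` is missed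
by one of them, the path stops there, so the path to `r` cannot be longer. -/
theorem end_unique (hR : ∀ u w w', R u w → R u w' → w = w')
    (hS : ∀ u w w', S u w → S u w' → w = w') (hR' : ∀ u w, R u w → R w u)
    (hS' : ∀ u w, S u w → S w u) {q r : V} (hq : (∀ w, ¬ R q w) ∨ (∀ w, ¬ S q w)) (hqp : q ≠ p)
    {i j : ℕ} (hi : AltPath R S p i q) (hj : AltPath R S p j r) (hij : i ≤ j) : q = r := by
  rcases hij.eq_or_lt with rfl | hij
  · exact unique hR hS hi hj
  obtain ⟨w, w₀, hw₀, h⟩ := exists_prefix hj hij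
  obtain rfl := unique hR hS hw₀ hi
  match i, hi with
  | 0, hi => exact absurd hi hqp
  | i + 1, ⟨w', hw', h'⟩ =>
    exfalso
    by_cases he : Even i
    · rw [if_pos he] at h'
      rw [if_neg (by simpa [Nat.even_add_one] using he)] at h
      rcases hq with hq | hq
      · exact hq _ (hR' _ _ h')
      · exact hq _ h
    · rw [if_neg he] at h'
      rw [if_pos (by simpa [Nat.even_add_one] using he)] at h
      rcases hq with hq | hq
      · exact hq _ h
      · exact hq _ (hS' _ _ h')

end AltPath

/-- A component of the union of two partial matchings has at most two vertices that are missed by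
one of the matchings. -/
theorem eq_of_reflTransGen_of_ends {V : Type*} {R S : V → V → Prop}
    (hR : ∀ u w w', R u w → R u w' → w = w')
    (hS : ∀ u w w', S u w → S u w' → w = w') (hR' : ∀ u w, R u w → R w u)
    (hS' : ∀ u w, S u w → S w u) {p q r : V} (hp : (∀ w, ¬ R p w) ∨ (∀ w, ¬ S p w))
    (hq : (∀ w, ¬ R q w) ∨ (∀ w, ¬ S q w)) (hr : (∀ w, ¬ R r w) ∨ (∀ w, ¬ S r w))
    (hqp : q ≠ p) (hrp : r ≠ p)
    (hpq : Relation.ReflTransGen (fun u w => R u w ∨ S u w) p q)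
    (hpr : Relation.ReflTransGen (fun u w => R u w ∨ S u w) p r) : q = r := by
  rcases hp with hp | hp
  -- Here `p` is missed by `R`, so its path must begin with `S` and the two relations exchange
  -- roles.
  · simp only [or_comm (a := R _ _)] at hpq hpr
    obtain ⟨i, hi⟩ := AltPath.of_reflTransGen hS hR hS' hR' hp hpq
    obtain ⟨j, hj⟩ := AltPath.of_reflTransGen hS hR hS' hR' hp hpr
    rcases le_total i j with h | h
    · exact AltPath.end_unique hS hR hS' hR' hq.symm hqp hi hj h
    · exact (AltPath.end_unique hS hR hS' hR' hr.symm hrp hj hi h).symm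
  · obtain ⟨i, hi⟩ := AltPath.of_reflTransGen hR hS hR' hS' hp hpq
    obtain ⟨j, hj⟩ := AltPath.of_reflTransGen hR hS hR' hS' hp hpr
    rcases le_total i j with h | h
    · exact AltPath.end_unique hR hS hR' hS' hq hqp hi hj h
    · exact (AltPath.end_unique hR hS hR' hS' hr hrp hj hi h).symm

/-! ## Partial edge colorings and Kempe chains -/

namespace Graph

variable {α : Type u} {β : Type v} {G : Graph α β} {t : ℕ} {c : β → ℕ}

/-- `c` is a partial proper edge coloring of `G` with colors `1, …, t`, where `0` stands for
uncolored edges. -/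
structure IsPartialColoring (G : Graph α β) (t : ℕ) (c : β → ℕ) : Prop where
  le : ∀ e ∈ E(G), c e ≤ t
  eq : ∀ e f x, G.Inc e x → G.Inc f x → c e = c f → c e ≠ 0 → e = f

/-- The number of colored edges. -/
noncomputable def coloredCard (G : Graph α β) (c : β → ℕ) : ℕ := {e ∈ E(G) | c e ≠ 0}.ncard

/-- The vertices `u` and `w` are joined by an edge of color `i`. -/
def ColorLink (G : Graph α β) (c : β → ℕ) (i : ℕ) (u w : α) : Prop := ∃ e, G.IsLink e u w ∧ c e = i

/-- The color `i` does not appear at the vertex `x`. -/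
def Misses (G : Graph α β) (c : β → ℕ) (x : α) (i : ℕ) : Prop := ∀ e, G.Inc e x → c e ≠ i

/-- `u` and `w` lie in the same component of the subgraph formed by the colors `i` and `j`. -/
def Chain (G : Graph α β) (c : β → ℕ) (i j : ℕ) : α → α → Prop :=
  Relation.ReflTransGen fun u w => G.ColorLink c i u w ∨ G.ColorLink c j u w

open Classical in
/-- Exchange the colors `i` and `j` on the component of `x` in the subgraph formed by them. -/
noncomputable def kempe (G : Graph α β) (c : β → ℕ) (x : α) (i j : ℕ) : β → ℕ := fun e =>
  if ∃ u, G.Inc e u ∧ G.Chain c i j x u then Equiv.swap i j (c e) else c e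

theorem ColorLink.symm {i : ℕ} {u w : α} (h : G.ColorLink c i u w) : G.ColorLink c i w u :=
  h.imp fun _ h => ⟨h.1.symm, h.2⟩

theorem Misses.not_colorLink {x : α} {i : ℕ} (h : G.Misses c x i) (w : α) : ¬ G.ColorLink c i x w :=
  fun ⟨e, he, hi⟩ => h e he.inc_left hi

theorem exists_of_not_misses {x : α} {i : ℕ} (h : ¬ G.Misses c x i) : ∃ e y, G.IsLink e x y ∧ c e = i := by
  simp only [Misses, not_forall, not_not] at h
  obtain ⟨e, ⟨y, hy⟩, h⟩ := h
  exact ⟨e, y, hy, h⟩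

theorem IsPartialColoring.colorLink_unique (hc : G.IsPartialColoring t c) {i : ℕ} (hi : i ≠ 0)
    (u w w' : α) (h : G.ColorLink c i u w) (h' : G.ColorLink c i u w') : w = w' := by
  obtain ⟨e, he, rfl⟩ := h
  obtain ⟨f, hf, hf'⟩ := h'
  obtain rfl := hc.eq e f u he.inc_left hf.inc_left hf'.symm hi
  exact he.right_unique hf

theorem IsPartialColoring.eq_of_chain (hc : G.IsPartialColoring t c) {i j : ℕ} (hi : i ≠ 0)
    (hj : j ≠ 0) {p q r : α} (hp : G.Misses c p i ∨ G.Misses c p j)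
    (hq : G.Misses c q i ∨ G.Misses c q j) (hr : G.Misses c r i ∨ G.Misses c r j)
    (hqp : q ≠ p) (hrp : r ≠ p) (hpq : G.Chain c i j p q) (hpr : G.Chain c i j p r) : q = r :=
  eq_of_reflTransGen_of_ends (hc.colorLink_unique hi) (hc.colorLink_unique hj)
    (fun _ _ => ColorLink.symm) (fun _ _ => ColorLink.symm)
    (hp.imp Misses.not_colorLink Misses.not_colorLink)
    (hq.imp Misses.not_colorLink Misses.not_colorLink)
    (hr.imp Misses.not_colorLink Misses.not_colorLink) hqp hrp hpq hpr

/-- Lets chains survive a shift of the uncolored edge, which disturbs no nonzero color other than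
the one moved. -/
theorem Chain.congr {c' : β → ℕ} {i j : ℕ} (h : ∀ e ∈ E(G), (c' e = i ↔ c e = i) ∧ (c' e = j ↔ c e = j)) :
    G.Chain c' i j = G.Chain c i j := by
  have key : ∀ k, (∀ e ∈ E(G), (c' e = k ↔ c e = k)) → G.ColorLink c' k = G.ColorLink c k := by
    intro k hk
    ext u w
    exact exists_congr fun e => and_congr_right fun he => hk e he.edge_mem
  unfold Chain
  rw [key i fun e he => (h e he).1, key j fun e he => (h e he).2]

theorem Chain.of_isLink {i j : ℕ} {x u w : α} {e : β} (h : G.Chain c i j x u) (he : G.IsLink e u w)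
    (hij : c e = i ∨ c e = j) : G.Chain c i j x w :=
  Relation.ReflTransGen.tail h (hij.imp (fun h => ⟨e, he, h⟩) (fun h => ⟨e, he, h⟩))

theorem swap_apply_eq_zero {i j k : ℕ} (hi : i ≠ 0) (hj : j ≠ 0) : Equiv.swap i j k = 0 ↔ k = 0 := by
  rw [Equiv.swap_apply_eq_iff, Equiv.swap_apply_of_ne_of_ne hi.symm hj.symm]

section Kempe

variable {i j : ℕ} {x u : α} {e : β}

theorem kempe_of_chain (he : G.Inc e u) (hu : G.Chain c i j x u) :
    G.kempe c x i j e = Equiv.swap i j (c e) := if_pos ⟨u, he, hu⟩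

/-- If another end of the edge lies in the component while `u` does not, the edge has neither of the
two colors, and the swap fixes its color. -/
theorem kempe_of_not_chain (he : G.Inc e u) (hu : ¬ G.Chain c i j x u) : G.kempe c x i j e = c e := by
  unfold kempe
  split_ifs with h
  · obtain ⟨w, hw, hxw⟩ := h
    refine Equiv.swap_apply_of_ne_of_ne (fun h => hu ?_) (fun h => hu ?_) <;>
    · obtain ⟨z, hz⟩ := hw
      rcases he.eq_or_eq_of_isLink hz with rfl | rfl
      · exact hxw
      · exact hxw.of_isLink hz (by tauto)
  · rfl

theorem kempe_of_ne (hi : c e ≠ i) (hj : c e ≠ j) : G.kempe c x i j e = c e := by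
  unfold kempe
  split_ifs
  · exact Equiv.swap_apply_of_ne_of_ne hi hj
  · rfl

theorem kempe_eq_iff_of_ne {k : ℕ} (hi : k ≠ i) (hj : k ≠ j) : G.kempe c x i j e = k ↔ c e = k := by
  unfold kempe
  split_ifs
  · rw [Equiv.swap_apply_eq_iff, Equiv.swap_apply_of_ne_of_ne hi hj]
  · rfl

theorem misses_kempe_of_ne {k : ℕ} (hi : k ≠ i) (hj : k ≠ j) :
    G.Misses (G.kempe c x i j) u k ↔ G.Misses c u k :=
  forall₂_congr fun _ _ => (kempe_eq_iff_of_ne hi hj).not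

theorem misses_kempe_of_not_chain {k : ℕ} (hu : ¬ G.Chain c i j x u) :
    G.Misses (G.kempe c x i j) u k ↔ G.Misses c u k :=
  forall₂_congr fun e he => by rw [kempe_of_not_chain he hu]

theorem misses_kempe_self (h : G.Misses c x i) : G.Misses (G.kempe c x i j) x j := by
  intro e he h'
  rw [kempe_of_chain he Relation.ReflTransGen.refl, Equiv.swap_apply_eq_iff, Equiv.swap_apply_right] at h'
  exact h e he h'

/-- All edges at one vertex are treated alike: their colors are permuted by the swap if the vertex
lies in the component, and are unchanged otherwise. Distinct colors stay distinct. -/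
theorem IsPartialColoring.kempe (hc : G.IsPartialColoring t c) (hi : i ≠ 0) (hj : j ≠ 0)
    (hi' : i ≤ t) (hj' : j ≤ t) : G.IsPartialColoring t (G.kempe c x i j) where
  le e he := by
    have := hc.le e he
    unfold Graph.kempe
    split_ifs
    · rw [Equiv.swap_apply_def]; split_ifs <;> omega
    · exact this
  eq e f y he hf hef h0 := by
    by_cases hy : G.Chain c i j x y
    · rw [kempe_of_chain he hy] at hef h0
      rw [kempe_of_chain hf hy] at hef
      exact hc.eq e f y he hf ((Equiv.swap i j).injective hef)
        (fun h => h0 (by rw [swap_apply_eq_zero hi hj, h]))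
    · rw [kempe_of_not_chain he hy] at hef h0
      rw [kempe_of_not_chain hf hy] at hef
      exact hc.eq e f y he hf hef h0

theorem kempe_eq_zero_iff (hi : i ≠ 0) (hj : j ≠ 0) : G.kempe c x i j e = 0 ↔ c e = 0 :=
  kempe_eq_iff_of_ne hi.symm hj.symm

theorem coloredCard_kempe (hi : i ≠ 0) (hj : j ≠ 0) :
    G.coloredCard (G.kempe c x i j) = G.coloredCard c := by
  simp [coloredCard, kempe_eq_zero_iff hi hj]

theorem kempe_self : G.kempe c x i i = c := by
  ext e; simp [Graph.kempe]

end Kempe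

end Graph

/-! ### Sparse multigraphs and counting of free colors -/

namespace Graph

variable {α : Type u} {β : Type v} {G : Graph α β} {t Δ : ℕ} {c : β → ℕ}

/-- The assumptions under which every partial `t`-coloring can be extended. -/
structure IsSparse (G : Graph α β) (t Δ : ℕ) : Prop where
  finite_vertexSet : V(G).Finite
  finite_edgeSet : E(G).Finite
  ne_of_isLink : ∀ {e x y}, G.IsLink e x y → x ≠ y
  ncard_incidenceSet_le : ∀ x ∈ V(G), (G.incidenceSet x).ncard ≤ Δ
  four_mul_le : 4 * Δ ≤ 3 * t
  ncard_induce_le : ∀ x ∈ V(G), ∀ y ∈ V(G), ∀ z ∈ V(G), x ≠ y → x ≠ z → y ≠ z →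
    E(G.induce {x, y, z}).ncard ≤ t

/-- The color `i` is one of `1, …, t` and does not appear at `x`. -/
def Free (G : Graph α β) (t : ℕ) (c : β → ℕ) (x : α) (i : ℕ) : Prop :=
  i ≠ 0 ∧ i ≤ t ∧ G.Misses c x i

open Classical in
/-- The set of free colors at `x`. -/
noncomputable def freeColors (G : Graph α β) (t : ℕ) (c : β → ℕ) (x : α) : Finset ℕ :=
  {i ∈ Finset.Icc 1 t | G.Misses c x i}

theorem mem_freeColors {x : α} {i : ℕ} : i ∈ G.freeColors t c x ↔ G.Free t c x i := by
  simp [freeColors, Free, and_assoc, Nat.one_le_iff_ne_zero]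

theorem IsSparse.finite_incidenceSet (hG : G.IsSparse t Δ) (x : α) : (G.incidenceSet x).Finite :=
  hG.finite_edgeSet.subset (G.incidenceSet_subset_edgeSet x)

theorem IsSparse.le_card_freeColors_aux (hG : G.IsSparse t Δ) (x : α) :
    t ≤ (G.freeColors t c x).card + {e ∈ G.incidenceSet x | c e ≠ 0}.ncard := by
  classical
  have hfin : {e ∈ G.incidenceSet x | c e ≠ 0}.Finite := (hG.finite_incidenceSet x).subset fun _ h => h.1
  have h : Finset.Icc 1 t ⊆ G.freeColors t c x ∪ hfin.toFinset.image c := by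
    intro i hi
    rw [Finset.mem_Icc] at hi
    by_cases h : G.Misses c x i
    · exact Finset.mem_union_left _ (mem_freeColors.2 ⟨by omega, hi.2, h⟩)
    · obtain ⟨e, y, he, rfl⟩ := exists_of_not_misses h
      exact Finset.mem_union_right _ (Finset.mem_image_of_mem c
        (by simpa using ⟨he.inc_left, by omega⟩))
  calc t = (Finset.Icc 1 t).card := by simp
    _ ≤ _ := Finset.card_le_card h
    _ ≤ _ := Finset.card_union_le _ _
    _ ≤ _ := by
      rw [Set.ncard_eq_toFinset_card _ hfin]
      exact Nat.add_le_add_left Finset.card_image_le _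

theorem IsSparse.le_card_freeColors (hG : G.IsSparse t Δ) {x : α} (hx : x ∈ V(G)) :
    t ≤ (G.freeColors t c x).card + Δ := by
  have h1 := hG.le_card_freeColors_aux (c := c) x
  have h2 : {e ∈ G.incidenceSet x | c e ≠ 0}.ncard ≤ (G.incidenceSet x).ncard :=
    Set.ncard_le_ncard (fun _ h => h.1) (hG.finite_incidenceSet x)
  have h3 := hG.ncard_incidenceSet_le x hx
  omega

/-- The uncolored edge counts towards the degree but occupies no color, which gains one free color.
-/
theorem IsSparse.lt_card_freeColors (hG : G.IsSparse t Δ) {x : α} {e : β} (he : G.Inc e x)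
    (h0 : c e = 0) : t < (G.freeColors t c x).card + Δ := by
  have h1 := hG.le_card_freeColors_aux (c := c) x
  have h2 : {e ∈ G.incidenceSet x | c e ≠ 0}.ncard < (G.incidenceSet x).ncard :=
    Set.ncard_lt_ncard (Set.ssubset_iff_subset_ne.2 ⟨fun _ h => h.1, fun h =>
      (h.ge (show e ∈ G.incidenceSet x from he)).2 h0⟩) (hG.finite_incidenceSet x)
  have h3 := hG.ncard_incidenceSet_le x he.vertex_mem
  omega

/-- The edge `e` forces `Δ > 0`, and then `4Δ ≤ 3t` gives `t > Δ`. -/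
theorem IsSparse.exists_free (hG : G.IsSparse t Δ) {x y : α} {e : β} (he : G.Inc e y)
    (hx : x ∈ V(G)) : ∃ i, G.Free t c x i := by
  have h1 : 0 < Δ := ((Set.ncard_pos (hG.finite_incidenceSet y)).2 ⟨e, he⟩).trans_le
    (hG.ncard_incidenceSet_le y he.vertex_mem)
  have h2 := hG.le_card_freeColors (c := c) hx
  have h3 := hG.four_mul_le
  obtain ⟨i, hi⟩ := Finset.card_pos.1 (show 0 < (G.freeColors t c x).card by omega)
  exact ⟨i, mem_freeColors.1 hi⟩

/-- Four vertices, two of which meet uncolored edges, do not have pairwise disjoint sets of free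
colors. -/
theorem IsSparse.exists_common_free (hG : G.IsSparse t Δ) {x y z w : α} {e f : β} (he : G.Inc e x)
    (he0 : c e = 0) (hf : G.Inc f y) (hf0 : c f = 0) (hz : z ∈ V(G)) (hw : w ∈ V(G))
    (hxy : ∀ i, G.Free t c x i → ¬ G.Free t c y i) (hxz : ∀ i, G.Free t c x i → ¬ G.Free t c z i)
    (hxw : ∀ i, G.Free t c x i → ¬ G.Free t c w i) (hyz : ∀ i, G.Free t c y i → ¬ G.Free t c z i)
    (hyw : ∀ i, G.Free t c y i → ¬ G.Free t c w i) : ∃ i, G.Free t c z i ∧ G.Free t c w i := by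
  by_contra! hzw
  simp only [← mem_freeColors] at *
  have h1 := hG.lt_card_freeColors he he0
  have h2 := hG.lt_card_freeColors hf hf0
  have h3 := hG.le_card_freeColors (c := c) hz
  have h4 := hG.le_card_freeColors (c := c) hw
  have h5 := hG.four_mul_le
  have hd1 : Disjoint (G.freeColors t c x) (G.freeColors t c y) := Finset.disjoint_left.2 hxy
  have hd2 : Disjoint (G.freeColors t c z) (G.freeColors t c w) := Finset.disjoint_left.2 hzw
  have hd : Disjoint (G.freeColors t c x ∪ G.freeColors t c y)
      (G.freeColors t c z ∪ G.freeColors t c w) := by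
    rw [Finset.disjoint_left]
    intro i hi
    rw [Finset.mem_union] at hi ⊢
    rintro (h | h) <;> rcases hi with hi | hi
    exacts [hxz i hi h, hyz i hi h, hxw i hi h, hyw i hi h]
  -- Four disjoint sets of free colors would have at least `4 (t - Δ) + 2` elements among `t`
  -- colors, against `4Δ ≤ 3t`.
  have h6 : (G.freeColors t c x ∪ G.freeColors t c y ∪
      (G.freeColors t c z ∪ G.freeColors t c w)).card ≤ (Finset.Icc 1 t).card :=
    Finset.card_le_card (by
      simp only [Finset.union_subset_iff]
      simp [freeColors, Finset.filter_subset])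
  rw [Finset.card_union_of_disjoint hd, Finset.card_union_of_disjoint hd1,
    Finset.card_union_of_disjoint hd2, Nat.card_Icc] at h6
  omega

theorem ne_of_free {x z : α} {f : β} (hf : G.Inc f z) (hx : G.Free t c x (c f)) : x ≠ z := by
  rintro rfl
  exact hx.2.2 f hf rfl

theorem ne_of_color {x : α} {e f : β} (h0 : c e = 0) (hx : G.Free t c x (c f)) : f ≠ e := by
  rintro rfl
  exact hx.1 h0

variable [DecidableEq β]

theorem IsPartialColoring.update (hc : G.IsPartialColoring t c) {e : β} {i : ℕ} (hi : i ≤ t)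
    (h : i ≠ 0 → ∀ f x, f ≠ e → G.Inc e x → G.Inc f x → c f ≠ i) :
    G.IsPartialColoring t (Function.update c e i) where
  le f hf := by
    rw [Function.update_apply]
    split_ifs
    exacts [hi, hc.le f hf]
  eq f g x hf hg hfg h0 := by
    by_contra hne
    rw [Function.update_apply] at hfg h0
    rw [Function.update_apply] at hfg
    split_ifs at hfg h0 with h1 h2 h2
    · exact hne (h1.trans h2.symm)
    · subst h1; exact h h0 g x h2 hf hg hfg.symm
    · subst h2; exact h (hfg ▸ h0) f x h1 hg hf hfg
    · exact hne (hc.eq f g x hf hg hfg h0)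

theorem coloredCard_update (hE : E(G).Finite) {e : β} {i : ℕ} (he : e ∈ E(G)) (h0 : c e = 0)
    (hi : i ≠ 0) : G.coloredCard (Function.update c e i) = G.coloredCard c + 1 := by
  have h : {f ∈ E(G) | Function.update c e i f ≠ 0} = insert e {f ∈ E(G) | c f ≠ 0} := by
    ext f
    by_cases hf : f = e
    · subst hf; simp [he, hi]
    · simp [hf]
  rw [coloredCard, h, Set.ncard_insert_of_notMem (by simp [h0]) (hE.subset fun _ h => h.1), coloredCard]

/-! ## Improving a coloring by a bounded number of steps -/

/-- Recolor an edge, then exchange two colors on a component. Properness is not required. -/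
def RecolorStep (G : Graph α β) (t : ℕ) (c c' : β → ℕ) : Prop :=
  ∃ e ∈ E(G), ∃ k ≤ t, ∃ x ∈ V(G), ∃ i ≤ t, ∃ j ≤ t, c' = G.kempe (Function.update c e k) x i j

/-- In `d` steps, `c` can be transformed into a partial coloring with more than `N` colored edges. -/
def Improvable (G : Graph α β) (t N : ℕ) : ℕ → (β → ℕ) → Prop
  | 0, c => G.IsPartialColoring t c ∧ N < G.coloredCard c
  | d + 1, c => ∃ c', G.RecolorStep t c c' ∧ Improvable G t N d c'

/-- A recoloring alone is a step, because exchanging color `0` with itself does nothing. -/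
theorem Improvable.of_update {N d : ℕ} {e : β} {k : ℕ} (he : e ∈ E(G)) (hk : k ≤ t)
    (h : G.Improvable t N d (Function.update c e k)) : G.Improvable t N (d + 1) c := by
  obtain ⟨x, _, hx⟩ := G.exists_isLink_of_mem_edgeSet he
  exact ⟨_, ⟨e, he, k, hk, x, hx.left_mem, 0, t.zero_le, 0, t.zero_le, rfl⟩, by rwa [kempe_self]⟩

/-- An exchange alone is a step, because the uncolored edge `e` may be recolored with `0`. -/
theorem Improvable.of_kempe {N d : ℕ} {e : β} {x : α} {i j : ℕ} (he : e ∈ E(G)) (h0 : c e = 0)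
    (hx : x ∈ V(G)) (hi : i ≤ t) (hj : j ≤ t)
    (h : G.Improvable t N d (G.kempe c x i j)) : G.Improvable t N (d + 1) c :=
  ⟨_, ⟨e, he, 0, t.zero_le, x, hx, i, hi, j, hj, rfl⟩, by rwa [← h0, Function.update_eq_self]⟩

theorem Improvable.mono {N d d' : ℕ} {e : β} (he : e ∈ E(G)) (h0 : c e = 0)
    (h : G.Improvable t N d c) (hd : d ≤ d') : G.Improvable t N d' c := by
  induction d', hd using Nat.le_induction with
  | base => exact h
  | succ d' _ ih => exact Improvable.of_update he t.zero_le (by rwa [← h0, Function.update_eq_self])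

theorem IsPartialColoring.improvable_of_free (hc : G.IsPartialColoring t c) (hG : G.IsSparse t Δ)
    {e : β} {x y : α} (he : G.IsLink e y x) (h0 : c e = 0) {i : ℕ} (hx : G.Free t c x i)
    (hy : G.Free t c y i) : G.Improvable t (G.coloredCard c) 1 c := by
  refine .of_update (k := i) he.edge_mem hx.2.1 ⟨hc.update hx.2.1 fun _ f u _ hu hf => ?_, ?_⟩
  · rcases hu.eq_or_eq_of_isLink he with rfl | rfl
    exacts [hy.2.2 f hf, hx.2.2 f hf]
  · rw [coloredCard_update hG.finite_edgeSet he.edge_mem h0 hx.1]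
    exact Nat.lt_succ_self _

/-- If the component of `y` avoids `x`, exchanging on it makes `i` free at `y` and leaves it free at
`x`; then `e` can take color `i`. This costs one exchange and one recoloring. -/
theorem IsPartialColoring.chain_or_improvable (hc : G.IsPartialColoring t c) (hG : G.IsSparse t Δ)
    {e : β} {x y : α} (he : G.IsLink e y x) (h0 : c e = 0) {i j : ℕ} (hx : G.Free t c x i)
    (hy : G.Free t c y j) : G.Chain c i j y x ∨ G.Improvable t (G.coloredCard c) 2 c := by
  refine or_iff_not_imp_left.2 fun h => ?_
  have h' : ¬ G.Chain c j i y x := by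
    unfold Chain at h ⊢
    simpa only [or_comm] using h
  refine .of_kempe he.edge_mem h0 he.left_mem hy.2.1 hx.2.1 (i := j) (j := i) ?_
  rw [← coloredCard_kempe hy.1 hx.1]
  refine (hc.kempe hy.1 hx.1 hy.2.1 hx.2.1).improvable_of_free hG he
    ((kempe_eq_zero_iff hy.1 hx.1).2 h0) ⟨hx.1, hx.2.1, ?_⟩ ⟨hx.1, hx.2.1, misses_kempe_self hy.2.2⟩
  exact (misses_kempe_of_not_chain h').2 hx.2.2

/-! ## Moving the uncolored edge -/

/-- Move the color of `f` to `e`. -/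
def shift (c : β → ℕ) (e f : β) : β → ℕ := Function.update (Function.update c f 0) e (c f)

section Shift

variable {e f g : β}

theorem shift_left : shift c e f e = c f := by simp [shift]

theorem shift_right (h : f ≠ e) : shift c e f f = 0 := by simp [shift, h]

theorem shift_of_ne (h : g ≠ e) (h' : g ≠ f) : shift c e f g = c g := by simp [shift, h, h']

theorem shift_eq_iff {i : ℕ} (h0 : c e = 0) (hi : i ≠ 0) (hif : i ≠ c f) :
    shift c e f g = i ↔ c g = i := by
  by_cases hge : g = e
  · subst hge; rw [shift_left, h0]; exact ⟨fun h => absurd h.symm hif, fun h => absurd h.symm hi⟩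
  by_cases hgf : g = f
  · subst hgf; rw [shift_right hge]; exact ⟨fun h => absurd h.symm hi, fun h => absurd h.symm hif⟩
  rw [shift_of_ne hge hgf]

theorem Free.shift {i : ℕ} {x : α} (h : G.Free t c x i) (h0 : c e = 0) (hif : i ≠ c f) :
    G.Free t (shift c e f) x i :=
  ⟨h.1, h.2.1, fun g hg h' => h.2.2 g hg ((shift_eq_iff h0 h.1 hif).1 h')⟩

variable {x y z : α}

/-- The moved color is free at `x`, and at `y` it was carried by `f` alone, which has been cleared.
-/
theorem IsPartialColoring.shift (hc : G.IsPartialColoring t c) (he : G.IsLink e y x)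
    (hf : G.Inc f y) (hx : G.Free t c x (c f)) : G.IsPartialColoring t (shift c e f) := by
  refine (hc.update t.zero_le (fun h => absurd rfl h)).update hx.2.1 fun _ g u hge hu hg => ?_
  rw [Function.update_apply]
  split_ifs with hgf
  · exact hx.1.symm
  rcases hu.eq_or_eq_of_isLink he with rfl | rfl
  · exact fun h => hgf (hc.eq g f _ hg hf h (h ▸ hx.1))
  · exact hx.2.2 g hg

theorem coloredCard_shift (hE : E(G).Finite) (he : e ∈ E(G)) (hf : f ∈ E(G)) (h0 : c e = 0)
    (hf0 : c f ≠ 0) : G.coloredCard (shift c e f) = G.coloredCard c := by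
  have hef : e ≠ f := by rintro rfl; exact hf0 h0
  rw [shift, coloredCard_update hE he (by simp [hef, h0]) hf0,
    ← coloredCard_update hE hf (by simp) hf0]
  simp

/-- Two steps: clear `f`, then color `e`. -/
theorem Improvable.of_shift {d N : ℕ} (h : G.Improvable t N d (Graph.shift c e f)) (he : e ∈ E(G))
    (hf : f ∈ E(G)) (hft : c f ≤ t) : G.Improvable t N (d + 2) c :=
  .of_update hf t.zero_le (.of_update he hft h)

/-- At `z` the color was carried by `f` only, and `e`, which receives it, does not meet `z`. -/
theorem IsPartialColoring.free_shift (hc : G.IsPartialColoring t c) (hG : G.IsSparse t Δ)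
    (he : G.IsLink e y x) (h0 : c e = 0) (hf : G.IsLink f y z) (hx : G.Free t c x (c f)) :
    G.Free t (Graph.shift c e f) z (c f) := by
  refine ⟨hx.1, hx.2.1, fun g hg h => ?_⟩
  by_cases hge : g = e
  · subst hge
    rcases hg.eq_or_eq_of_isLink he with rfl | rfl
    · exact hG.ne_of_isLink hf rfl
    · exact ne_of_free hf.inc_right hx rfl
  by_cases hgf : g = f
  · subst hgf
    rw [shift_right hge] at h
    exact hx.1 h.symm
  rw [shift_of_ne hge hgf] at h
  exact hgf (hc.eq g f z hg hf.inc_right h (h ▸ hx.1))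

end Shift

end Graph

namespace Graph

variable {α : Type u} {β : Type v} {G : Graph α β} {t Δ : ℕ} {c : β → ℕ}
  {e f g : β} {x y z w : α} {i j : ℕ}

/-! ## Closed triples -/

/-- The edges in the colors free at one of the vertices `x`, `y`, `z` join the other two. -/
structure IsClosedTriple (G : Graph α β) (t : ℕ) (c : β → ℕ) (x y z : α) : Prop where
  ne_xz : x ≠ z
  ne_yz : y ≠ z
  mem : z ∈ V(G)
  not_free_xy : ∀ i, G.Free t c x i → ¬ G.Free t c y i
  not_free_xz : ∀ i, G.Free t c x i → ¬ G.Free t c z i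
  not_free_yz : ∀ i, G.Free t c y i → ¬ G.Free t c z i
  link_x : ∀ i, G.Free t c x i → G.ColorLink c i y z
  link_y : ∀ i, G.Free t c y i → G.ColorLink c i x z
  link_z : ∀ i, G.Free t c z i → G.ColorLink c i x y

theorem IsClosedTriple.symm (h : G.IsClosedTriple t c x y z) : G.IsClosedTriple t c y x z where
  ne_xz := h.ne_yz
  ne_yz := h.ne_xz
  mem := h.mem
  not_free_xy i hy hx := h.not_free_xy i hx hy
  not_free_xz := h.not_free_yz
  not_free_yz := h.not_free_xz
  link_x := h.link_y
  link_y := h.link_x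
  link_z i hi := (h.link_z i hi).symm

variable [DecidableEq β]

/-! ## Fans -/

/-- After shifting the color of `f` to `e`, the uncolored edge joins `y` and `z`, and a color free
at both ends would finish in `2 + 1` steps. -/
theorem IsPartialColoring.not_free_center (hc : G.IsPartialColoring t c) (hG : G.IsSparse t Δ)
    (he : G.IsLink e y x) (h0 : c e = 0) (hf : G.IsLink f y z) (hx : G.Free t c x (c f))
    (hn : ¬ G.Improvable t (G.coloredCard c) 4 c) (hz : G.Free t c z i) : ¬ G.Free t c y i := by
  intro hy
  have hif : i ≠ c f := fun h => hy.2.2 f hf.inc_left h.symm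
  refine hn (.mono (d := 3) he.edge_mem h0 (.of_shift (e := e) (f := f) ?_ he.edge_mem hf.edge_mem hx.2.1)
    (by norm_num))
  rw [← coloredCard_shift hG.finite_edgeSet he.edge_mem hf.edge_mem h0 hx.1]
  exact (hc.shift he hf.inc_left hx).improvable_of_free hG hf (shift_right (ne_of_color h0 hx))
    (hz.shift h0 hif) (hy.shift h0 hif)

/-- After the shift the uncolored edge is `f`, and `chain_or_improvable` applies to it; the budget
is `2 + 2`. The shift does not touch the colors `i` and `j`, so the chain already exists for `c`. -/
theorem IsPartialColoring.chain_of_fan (hc : G.IsPartialColoring t c) (hG : G.IsSparse t Δ)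
    (he : G.IsLink e y x) (h0 : c e = 0) (hf : G.IsLink f y z) (hx : G.Free t c x (c f))
    (hn : ¬ G.Improvable t (G.coloredCard c) 4 c) (hz : G.Free t c z i) (hy : G.Free t c y j) :
    G.Chain c i j y z := by
  have hif : i ≠ c f := fun h => hz.2.2 f hf.inc_right h.symm
  have hjf : j ≠ c f := fun h => hy.2.2 f hf.inc_left h.symm
  by_contra hch
  refine hn (.of_shift (e := e) (f := f) ?_ he.edge_mem hf.edge_mem hx.2.1)
  rw [← coloredCard_shift hG.finite_edgeSet he.edge_mem hf.edge_mem h0 hx.1]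
  refine ((hc.shift he hf.inc_left hx).chain_or_improvable hG hf (shift_right (ne_of_color h0 hx))
    (hz.shift h0 hif) (hy.shift h0 hjf)).resolve_left ?_
  rwa [Chain.congr fun g _ => ⟨shift_eq_iff h0 hz.1 hif, shift_eq_iff h0 hy.1 hjf⟩]

theorem IsPartialColoring.not_free_ends (hc : G.IsPartialColoring t c) (hG : G.IsSparse t Δ)
    (he : G.IsLink e y x) (h0 : c e = 0) (hn : ¬ G.Improvable t (G.coloredCard c) 4 c)
    (hx : G.Free t c x i) : ¬ G.Free t c y i := fun hy =>
  hn (.mono he.edge_mem h0 (hc.improvable_of_free hG he h0 hx hy) (by norm_num))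

theorem IsPartialColoring.chain_of_ends (hc : G.IsPartialColoring t c) (hG : G.IsSparse t Δ)
    (he : G.IsLink e y x) (h0 : c e = 0) (hn : ¬ G.Improvable t (G.coloredCard c) 4 c)
    (hx : G.Free t c x i) (hy : G.Free t c y j) : G.Chain c i j y x :=
  (hc.chain_or_improvable hG he h0 hx hy).resolve_right fun h =>
    hn (.mono he.edge_mem h0 h (by norm_num))

/-- With `j` free at `y`, the chain from `y` in the colors `i` and `j` would have to end both at `x`
and at `z`. -/
theorem IsPartialColoring.not_free_leaf (hc : G.IsPartialColoring t c) (hG : G.IsSparse t Δ)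
    (he : G.IsLink e y x) (h0 : c e = 0) (hf : G.IsLink f y z) (hx : G.Free t c x (c f))
    (hn : ¬ G.Improvable t (G.coloredCard c) 4 c) (hxi : G.Free t c x i) : ¬ G.Free t c z i := by
  intro hz
  obtain ⟨j, hy⟩ := hG.exists_free (c := c) he.inc_left he.left_mem
  exact ne_of_free hf.inc_right hx (hc.eq_of_chain hxi.1 hy.1 (Or.inr hy.2.2) (Or.inl hxi.2.2)
    (Or.inl hz.2.2) (hG.ne_of_isLink he).symm (hG.ne_of_isLink hf).symm
    (hc.chain_of_ends hG he h0 hn hxi hy) (hc.chain_of_fan hG he h0 hf hx hn hz hy))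

/-- All edges at `y` in colors free at `x` have the same second end. -/
theorem IsPartialColoring.fan_unique (hc : G.IsPartialColoring t c) (hG : G.IsSparse t Δ)
    (he : G.IsLink e y x) (h0 : c e = 0) (hf : G.IsLink f y z) (hx : G.Free t c x (c f))
    (hg : G.IsLink g y w) (hx' : G.Free t c x (c g))
    (hn : ¬ G.Improvable t (G.coloredCard c) 4 c) : z = w := by
  -- All pairs among `y`, `x`, `z`, `w` except `z`, `w` are known to have disjoint free sets, so `z`
  -- and `w` share a free color. The chain from `y` then ends at both of them.
  obtain ⟨i, hz, hw⟩ := hG.exists_common_free (c := c) he.inc_left h0 he.inc_right h0 hf.right_mem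
    hg.right_mem (fun i hy hx => hc.not_free_ends hG he h0 hn hx hy)
    (fun i hy hz => hc.not_free_center hG he h0 hf hx hn hz hy)
    (fun i hy hz => hc.not_free_center hG he h0 hg hx' hn hz hy)
    (fun i => hc.not_free_leaf hG he h0 hf hx hn) (fun i => hc.not_free_leaf hG he h0 hg hx' hn)
  obtain ⟨j, hy⟩ := hG.exists_free (c := c) he.inc_left he.left_mem
  exact hc.eq_of_chain hz.1 hy.1 (Or.inr hy.2.2) (Or.inl hz.2.2) (Or.inl hw.2.2)
    (hG.ne_of_isLink hf).symm (hG.ne_of_isLink hg).symm (hc.chain_of_fan hG he h0 hf hx hn hz hy)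
    (hc.chain_of_fan hG he h0 hg hx' hn hw hy)

/-- All edges at `y` in colors free at the leaf `z` of the fan have `x` as their second end. -/
theorem IsPartialColoring.fan_unique_leaf (hc : G.IsPartialColoring t c) (hG : G.IsSparse t Δ)
    (he : G.IsLink e y x) (h0 : c e = 0) (hf : G.IsLink f y z) (hx : G.Free t c x (c f))
    (hg : G.IsLink g y w) (hz : G.Free t c z (c g))
    (hn : ¬ G.Improvable t (G.coloredCard c) 6 c) : w = x := by
  by_contra hwx
  have hfe := ne_of_color h0 hx
  have hgf : g ≠ f := by rintro rfl; exact hz.2.2 g hf.inc_right rfl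
  have hge : g ≠ e := by rintro rfl; exact hz.1 h0
  have hcgf : c g ≠ c f := fun h => hz.2.2 f hf.inc_right h.symm
  -- After the shift `f` is the uncolored edge between `y` and `z`, and both `g` and `e` leave `y`
  -- in colors free at `z`. Uniqueness of the leaf gives `w = x`; the budget is `2 + 4`.
  refine hwx (IsPartialColoring.fan_unique (c := Graph.shift c e f) (e := f) (f := g) (g := e) (x := z)
    (hc.shift he hf.inc_left hx) hG hf (shift_right hfe) hg ?_ he ?_ fun h => hn ?_)
  · rw [shift_of_ne hge hgf]; exact hz.shift h0 hcgf
  · rw [shift_left]; exact hc.free_shift hG he h0 hf hx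
  · rw [coloredCard_shift hG.finite_edgeSet he.edge_mem hf.edge_mem h0 hx.1] at h
    exact h.of_shift he.edge_mem hf.edge_mem hx.2.1

theorem IsPartialColoring.exists_isClosedTriple (hc : G.IsPartialColoring t c) (hG : G.IsSparse t Δ)
    (he : G.IsLink e x y) (h0 : c e = 0) (hn : ¬ G.Improvable t (G.coloredCard c) 6 c) :
    ∃ z, G.IsClosedTriple t c x y z := by
  have hn4 : ¬ G.Improvable t (G.coloredCard c) 4 c := fun h =>
    hn (h.mono he.edge_mem h0 (by norm_num))
  have hxy : ∀ i, G.Free t c x i → ¬ G.Free t c y i := fun i hx =>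
    hc.not_free_ends hG he.symm h0 hn4 hx
  have hleaf : ∀ {x y}, G.IsLink e x y → ∃ f z, G.IsLink f y z ∧ G.Free t c x (c f) := by
    intro x y he
    obtain ⟨i, hi⟩ := hG.exists_free (c := c) he.inc_left he.left_mem
    obtain ⟨f, z, hf, rfl⟩ := exists_of_not_misses (x := y) (i := i) fun h =>
      hc.not_free_ends hG he h0 hn4 ⟨hi.1, hi.2.1, h⟩ hi
    exact ⟨f, z, hf, hi⟩
  obtain ⟨f, z, hf, hfx⟩ := hleaf he
  obtain ⟨f', z', hf', hfy⟩ := hleaf he.symm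
  have hxz := fun i => hc.not_free_leaf hG he.symm h0 hf hfx hn4 (i := i)
  have hyz' := fun i => hc.not_free_leaf hG he h0 hf' hfy hn4 (i := i)
  have hyz := fun i h h' => hc.not_free_center hG he.symm h0 hf hfx hn4 (i := i) h' h
  have hxz' := fun i h h' => hc.not_free_center hG he h0 hf' hfy hn4 (i := i) h' h
  -- If the leaves of the two fans differ, counting gives them a common free color. At `y` that
  -- color leads to `x`, and from there the color of `f'`, free at `y`, leads to `z'`. This chain
  -- from `y` ends at `z'`, while `chain_of_fan` makes it end at `z`.
  obtain rfl : z = z' := by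
    by_contra hzz
    obtain ⟨i, hz, hz'⟩ := hG.exists_common_free (c := c) he.inc_left h0 he.inc_right h0 hf.right_mem
      hf'.right_mem hxy hxz hxz' hyz hyz'
    obtain ⟨g, w, hg, rfl⟩ := exists_of_not_misses (x := y) (i := i) fun h =>
      hyz i ⟨hz.1, hz.2.1, h⟩ hz
    obtain rfl := hc.fan_unique_leaf hG he.symm h0 hf hfx hg hz hn
    have hch : G.Chain c (c g) (c f') y z' :=
      Chain.of_isLink (.of_isLink .refl hg (Or.inl rfl)) hf' (Or.inr rfl)
    have hyz'ne : y ≠ z' := ne_of_free hf'.inc_right hfy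
    exact hzz (hc.eq_of_chain hz.1 hfy.1 (Or.inr hfy.2.2) (Or.inl hz.2.2) (Or.inl hz'.2.2)
      (hG.ne_of_isLink hf).symm hyz'ne.symm
      (hc.chain_of_fan hG he.symm h0 hf hfx hn4 hz hfy) hch)
  refine ⟨z, hG.ne_of_isLink hf', hG.ne_of_isLink hf, hf.right_mem, hxy, hxz, hyz, ?_, ?_, ?_⟩
  · intro i hi
    obtain ⟨g, w, hg, rfl⟩ := exists_of_not_misses (x := y) (i := i) fun h =>
      hxy i hi ⟨hi.1, hi.2.1, h⟩
    obtain rfl := hc.fan_unique hG he.symm h0 hf hfx hg hi hn4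
    exact ⟨g, hg, rfl⟩
  · intro i hi
    obtain ⟨g, w, hg, rfl⟩ := exists_of_not_misses (x := x) (i := i) fun h =>
      hxy i ⟨hi.1, hi.2.1, h⟩ hi
    obtain rfl := hc.fan_unique hG he h0 hf' hfy hg hi hn4
    exact ⟨g, hg, rfl⟩
  · intro i hi
    obtain ⟨g, w, hg, rfl⟩ := exists_of_not_misses (x := y) (i := i) fun h =>
      hyz i ⟨hi.1, hi.2.1, h⟩ hi
    obtain rfl := hc.fan_unique_leaf hG he.symm h0 hf hfx hg hi hn
    exact ⟨g, hg.symm, rfl⟩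

/-- A recoloring that keeps a color free at `x` on its edge from `y` to `z` preserves the closed
triple. -/
theorem IsClosedTriple.of_recoloring {c' : β → ℕ} (hc' : G.IsPartialColoring t c')
    (hG : G.IsSparse t Δ) (he : G.IsLink e x y) (h0 : c' e = 0)
    (hn : ¬ G.Improvable t (G.coloredCard c') 6 c') (hx : G.Free t c' x i)
    (hi : G.ColorLink c' i y z) : G.IsClosedTriple t c' x y z := by
  obtain ⟨z', hz'⟩ := hc'.exists_isClosedTriple hG he h0 hn
  -- In the closed triple obtained for `c'`, the edge of color `i` at `y` leads to the third vertex;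
  -- properness leaves only `z`.
  obtain rfl := hc'.colorLink_unique hx.1 _ _ _ hi (hz'.link_x i hx)
  exact hz'

end Graph

namespace Graph

variable {α : Type u} {β : Type v} [DecidableEq β] {G : Graph α β} {t Δ : ℕ} {c : β → ℕ}
  {e f g : β} {x y z w : α} {i j : ℕ}

/-! ## Colors without an edge inside a closed triple -/

/-- Exchange `i` and `j` on the component of `z`. A color free at `x` differs from both and keeps
its edge from `y` to `z`, so the triple stays closed. Now `j` is free at `z` and must join `x` and
`y`; but `x` lies outside the component, so that edge had color `j` before. -/
theorem IsClosedTriple.improvable_of_not_chain (hT : G.IsClosedTriple t c x y z)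
    (hc : G.IsPartialColoring t c) (hG : G.IsSparse t Δ) (he : G.IsLink e x y) (h0 : c e = 0)
    (hi : G.Free t c z i) (hj : j ≠ 0) (hjt : j ≤ t) (hxy : ¬ G.ColorLink c j x y)
    (hyz : ¬ G.ColorLink c j y z) (hch : ¬ G.Chain c i j z x) :
    G.Improvable t (G.coloredCard c) 7 c := by
  by_contra hn
  obtain ⟨k, hk⟩ := hG.exists_free (c := c) he.inc_left he.left_mem
  have hki : k ≠ i := by rintro rfl; exact hT.not_free_xz k hk hi
  have hkj : k ≠ j := by rintro rfl; exact hyz (hT.link_x k hk)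
  obtain ⟨h, hh, hhk⟩ := hT.link_x k hk
  have hT' : G.IsClosedTriple t (G.kempe c z i j) x y z := by
    refine .of_recoloring (hc.kempe hi.1 hj hi.2.1 hjt) hG he ((kempe_eq_zero_iff hi.1 hj).2 h0)
      (fun h => hn (.of_kempe he.edge_mem h0 hT.mem hi.2.1 hjt ?_))
      ⟨hk.1, hk.2.1, (misses_kempe_of_ne hki hkj).2 hk.2.2⟩ ⟨h, hh, (kempe_eq_iff_of_ne hki hkj).2 hhk⟩
    rwa [← coloredCard_kempe hi.1 hj]
  obtain ⟨f, hf, hfj⟩ := hT'.link_z j ⟨hj, hjt, misses_kempe_self hi.2.2⟩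
  rw [kempe_of_not_chain hf.inc_left hch] at hfj
  exact hxy ⟨f, hf, hfj⟩

/-- Here the path from `z` in the colors `c g` and `j` reaches `x` without using `g`, so it misses
`y`. First exchange the color of `g` with a color free at `y`, along the short path from `y` over
`g` to `x` and over `h` to `z`. The color `c g` becomes free at `y`, and the new chain of `y` in the
colors `c g` and `j` avoids `x`. Exchanging on that chain makes `j` free at `y`, so the closed
triple demands an edge of color `j` between `x` and `z`, which must have been there already. -/
theorem IsClosedTriple.improvable_of_reflTransGen (hT : G.IsClosedTriple t c x y z)
    (hc : G.IsPartialColoring t c) (hG : G.IsSparse t Δ) (he : G.IsLink e x y) (h0 : c e = 0)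
    (hz : G.Free t c z (c g)) (hg : G.IsLink g x y) (hj : j ≠ 0) (hjt : j ≤ t)
    (hxy : ¬ G.ColorLink c j x y) (hyz : ¬ G.ColorLink c j y z) (hxz : ¬ G.ColorLink c j x z)
    (hch : Relation.ReflTransGen
      (fun u w => (∃ f, G.IsLink f u w ∧ c f = c g ∧ f ≠ g) ∨ G.ColorLink c j u w) z x) :
    G.Improvable t (G.coloredCard c) 8 c := by
  by_contra hn
  set R : α → α → Prop := fun u w => ∃ f, G.IsLink f u w ∧ c f = c g ∧ f ≠ g with hR
  have hRs : ∀ u w, R u w → R w u := fun u w ⟨f, hf, h⟩ => ⟨f, hf.symm, h⟩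
  have hRg : ∀ u, G.Inc g u → ∀ w, ¬ R u w := fun u hu w ⟨f, hf, hfg, hne⟩ =>
    hne (hc.eq f g u hf.inc_left hu hfg (hfg ▸ hz.1))
  -- Once `g` is removed, each of `x`, `y`, `z` misses the color `c g`, so all three are path ends,
  -- and a path starting at `z` cannot end at both `x` and `y`.
  have hzy : ¬ Relation.ReflTransGen (fun u w => R u w ∨ G.ColorLink c j u w) z y := fun h =>
    hG.ne_of_isLink he (eq_of_reflTransGen_of_ends
      (fun u w w' ⟨f, hf, hfg, _⟩ ⟨f', hf', hfg', _⟩ =>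
        hc.colorLink_unique hz.1 u w w' ⟨f, hf, hfg⟩ ⟨f', hf', hfg'⟩)
      (hc.colorLink_unique hj) hRs (fun _ _ => ColorLink.symm)
      (Or.inl fun w ⟨f, hf, hfg, _⟩ => hz.2.2 f hf.inc_left hfg) (Or.inl (hRg x hg.inc_left))
      (Or.inl (hRg y hg.inc_right)) hT.ne_xz hT.ne_yz hch h)
  have hsymm : ∀ {u w}, Relation.ReflTransGen (fun u w => R u w ∨ G.ColorLink c j u w) u w →
      Relation.ReflTransGen (fun u w => R u w ∨ G.ColorLink c j u w) w u := fun {u w} h => by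
    induction h with
    | refl => exact .refl
    | tail _ h ih => exact .head (h.imp (hRs _ _) ColorLink.symm) ih
  have hyz' := fun h => hzy (hsymm h)
  have hyx' : ¬ Relation.ReflTransGen (fun u w => R u w ∨ G.ColorLink c j u w) y x := fun h =>
    hyz' (h.trans (hsymm hch))
  obtain ⟨k, hk⟩ := hG.exists_free (c := c) he.inc_left he.right_mem
  obtain ⟨h, hh, rfl⟩ := hT.link_y k hk
  have hkg : c h ≠ c g := fun heq => hT.not_free_yz _ hk (heq ▸ hz)
  have hkj : c h ≠ j := by rintro rfl; exact hxz ⟨h, hh, rfl⟩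
  have hgj : c g ≠ j := by rintro rfl; exact hxy ⟨g, hg, rfl⟩
  obtain ⟨l, hl⟩ := hG.exists_free (c := c) he.inc_left he.left_mem
  have hlg : l ≠ c g := by rintro rfl; exact hT.not_free_xz _ hl hz
  have hlh : l ≠ c h := by rintro rfl; exact hT.not_free_xy _ hl hk
  have hlj : l ≠ j := by rintro rfl; exact hyz (hT.link_x l hl)
  -- The component of `y` in these two colors consists of `g` and `h` only: `y` misses `c h`, `z`
  -- misses `c g`, and `x` meets exactly `g` and `h`.
  have hcomp : ∀ u, G.Chain c (c h) (c g) y u →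
      ∀ f, G.Inc f u → (c f = c h → f = h) ∧ (c f = c g → f = g) := by
    have hx : ∀ f, G.Inc f x → (c f = c h → f = h) ∧ (c f = c g → f = g) := fun f hf =>
      ⟨fun e => hc.eq f h x hf hh.inc_left e (e ▸ hk.1), fun e => hc.eq f g x hf hg.inc_left e (e ▸ hz.1)⟩
    have hy : ∀ f, G.Inc f y → (c f = c h → f = h) ∧ (c f = c g → f = g) := fun f hf =>
      ⟨fun e => absurd e (hk.2.2 f hf), fun e => hc.eq f g y hf hg.inc_right e (e ▸ hz.1)⟩
    have hz' : ∀ f, G.Inc f z → (c f = c h → f = h) ∧ (c f = c g → f = g) := fun f hf =>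
      ⟨fun e => hc.eq f h z hf hh.inc_right e (e ▸ hk.1), fun e => absurd e (hz.2.2 f hf)⟩
    suffices ∀ u, G.Chain c (c h) (c g) y u → u = x ∨ u = y ∨ u = z by
      intro u hu
      rcases this u hu with rfl | rfl | rfl
      exacts [hx, hy, hz']
    intro u hu
    induction hu with
    | refl => exact Or.inr (Or.inl rfl)
    | @tail u w _ huw ih =>
      have hall : ∀ f, G.Inc f u → (c f = c h → f = h) ∧ (c f = c g → f = g) := by
        rcases ih with rfl | rfl | rfl
        exacts [hx, hy, hz']
      rcases huw with ⟨f, hf, hfc⟩ | ⟨f, hf, hfc⟩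
      · obtain rfl := (hall f hf.inc_left).1 hfc
        rcases hf.inc_right.eq_or_eq_of_isLink hh with rfl | rfl <;> simp
      · obtain rfl := (hall f hf.inc_left).2 hfc
        rcases hf.inc_right.eq_or_eq_of_isLink hg with rfl | rfl <;> simp
  set c₁ := G.kempe c y (c h) (c g) with hc₁
  have hc₁P : G.IsPartialColoring t c₁ := hc.kempe hk.1 hz.1 hk.2.1 hz.2.1
  have hc₁g : c₁ g = c h := by
    rw [hc₁, kempe_of_chain hg.inc_right .refl, Equiv.swap_apply_right]
  have hc₁h : c₁ h = c g := by
    rw [hc₁, kempe_of_chain hh.inc_left (.of_isLink .refl hg.symm (Or.inr rfl)), Equiv.swap_apply_left]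
  have hc₁f : ∀ f, f ≠ g → f ≠ h → c₁ f = c f := by
    intro f hfg hfh
    by_cases hex : ∃ u, G.Inc f u ∧ G.Chain c (c h) (c g) y u
    · obtain ⟨u, hu, hyu⟩ := hex
      exact kempe_of_ne (fun e => hfh ((hcomp u hyu f hu).1 e)) (fun e => hfg ((hcomp u hyu f hu).2 e))
    · exact if_neg hex
  -- The exchange alters only `g`, which now has neither color, and `h`, whose ends `x` and `z` are
  -- unreachable from `y`. So the new chain of `y` already existed without `g`.
  have hch₁ : ∀ u, G.Chain c₁ (c g) j y u →
      Relation.ReflTransGen (fun u w => R u w ∨ G.ColorLink c j u w) y u := by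
    intro u hu
    induction hu with
    | refl => exact .refl
    | @tail u w _ huw ih =>
      refine ih.tail ?_
      rcases huw with ⟨f, hf, hfc⟩ | ⟨f, hf, hfc⟩
      · have hfg : f ≠ g := by rintro rfl; exact hkg (hc₁g.symm.trans hfc)
        have hfh : f ≠ h := by
          rintro rfl
          rcases hf.inc_left.eq_or_eq_of_isLink hh with rfl | rfl
          exacts [hyx' ih, hyz' ih]
        exact Or.inl ⟨f, hf, by rw [← hc₁f f hfg hfh, hfc], hfg⟩
      · have hfg : f ≠ g := by rintro rfl; exact hkj (hc₁g.symm.trans hfc)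
        have hfh : f ≠ h := by rintro rfl; exact hgj (hc₁h.symm.trans hfc)
        exact Or.inr ⟨f, hf, by rw [← hc₁f f hfg hfh, hfc]⟩
  have hc₁0 : c₁ e = 0 := (kempe_eq_zero_iff hk.1 hz.1).2 h0
  -- The color `l`, free at `x`, takes part in neither exchange; its edge from `y` to `z` preserves
  -- the triple. Two exchanges on top of the budget `6` give `8`.
  have hT' : G.IsClosedTriple t (G.kempe c₁ y (c g) j) x y z := by
    obtain ⟨f, hf, hfl⟩ := hT.link_x l hl
    refine .of_recoloring (hc₁P.kempe hz.1 hj hz.2.1 hjt) hG he ((kempe_eq_zero_iff hz.1 hj).2 hc₁0)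
      (fun h' => hn ?_)
      ⟨hl.1, hl.2.1, (misses_kempe_of_ne hlg hlj).2 ((misses_kempe_of_ne hlh hlg).2 hl.2.2)⟩
      ⟨f, hf, (kempe_eq_iff_of_ne hlg hlj).2 ((kempe_eq_iff_of_ne hlh hlg).2 hfl)⟩
    rw [coloredCard_kempe hz.1 hj, coloredCard_kempe hk.1 hz.1] at h'
    exact .of_kempe he.edge_mem h0 he.right_mem hk.2.1 hz.2.1
      (.of_kempe he.edge_mem hc₁0 he.right_mem hz.2.1 hjt h')
  obtain ⟨f, hf, hfj⟩ := hT'.link_y j ⟨hj, hjt, misses_kempe_self (misses_kempe_self hk.2.2)⟩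
  rw [kempe_of_not_chain hf.inc_left fun h => hyx' (hch₁ x h),
    kempe_eq_iff_of_ne hkj.symm hgj.symm] at hfj
  exact hxz ⟨f, hf, hfj⟩

/-- Suppose `j` has no edge inside, and let `g` be the edge between `x` and `y` in a color free at
`z`. If the chain of `z` in the colors `c g` and `j` avoids `x`, one exchange suffices. Otherwise
the chain reaches `x` or `y` before using `g`, and by symmetry the two-exchange argument applies. -/
theorem IsClosedTriple.colorLink_inside (hT : G.IsClosedTriple t c x y z)
    (hc : G.IsPartialColoring t c) (hG : G.IsSparse t Δ) (he : G.IsLink e x y) (h0 : c e = 0)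
    (hj : j ≠ 0) (hjt : j ≤ t) (hn : ¬ G.Improvable t (G.coloredCard c) 8 c) :
    G.ColorLink c j x y ∨ G.ColorLink c j y z ∨ G.ColorLink c j x z := by
  by_contra! ⟨hxy, hyz, hxz⟩
  obtain ⟨i, hi⟩ := hG.exists_free (c := c) he.inc_left hT.mem
  obtain ⟨g, hg, rfl⟩ := hT.link_z i hi
  have hch : G.Chain c (c g) j z x := by
    by_contra hch
    exact hn (.mono he.edge_mem h0
      (hT.improvable_of_not_chain hc hG he h0 hi hj hjt hxy hyz hch) (by norm_num))
  -- A walk from `z` either avoids `g` throughout, or it reached an end of `g`, that is `x` or `y`,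
  -- before its first use of `g`.
  have key : ∀ u, G.Chain c (c g) j z u → ∀ r : α → α → Prop,
      (r = fun u w => (∃ f, G.IsLink f u w ∧ c f = c g ∧ f ≠ g) ∨ G.ColorLink c j u w) →
      Relation.ReflTransGen r z x ∨ Relation.ReflTransGen r z y ∨ Relation.ReflTransGen r z u := by
    intro u hu r hr
    induction hu with
    | refl => exact Or.inr (Or.inr .refl)
    | @tail u w _ huw ih =>
      rcases ih with h | h | h
      · exact Or.inl h
      · exact Or.inr (Or.inl h)
      rcases huw with ⟨f, hf, hfc⟩ | huw
      · by_cases hfg : f = g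
        · subst hfg
          rcases hf.inc_left.eq_or_eq_of_isLink hg with rfl | rfl
          · exact Or.inl h
          · exact Or.inr (Or.inl h)
        · exact Or.inr (Or.inr (h.tail (hr ▸ Or.inl ⟨f, hf, hfc, hfg⟩)))
      · exact Or.inr (Or.inr (h.tail (hr ▸ Or.inr huw)))
  have hx : ∀ h, Relation.ReflTransGen
      (fun u w => (∃ f, G.IsLink f u w ∧ c f = c g ∧ f ≠ g) ∨ G.ColorLink c j u w) z x → h := fun h hx =>
    (hn (hT.improvable_of_reflTransGen hc hG he h0 hi hg hj hjt hxy hyz hxz hx)).elim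
  rcases key x hch _ rfl with h | h | h
  · exact hx _ h
  · exact hn (hT.symm.improvable_of_reflTransGen hc hG he.symm h0 hi hg.symm hj hjt
      (fun h => hxy h.symm) hxz hyz h)
  · exact hx _ h

/-- A partial coloring of a sparse multigraph that leaves an edge uncolored can be improved in
eight steps. -/
theorem IsPartialColoring.improvable (hc : G.IsPartialColoring t c) (hG : G.IsSparse t Δ)
    (he : e ∈ E(G)) (h0 : c e = 0) : G.Improvable t (G.coloredCard c) 8 c := by
  by_contra hn
  obtain ⟨x, y, hxy⟩ := G.exists_isLink_of_mem_edgeSet he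
  obtain ⟨z, hT⟩ := hc.exists_isClosedTriple hG hxy h0 fun h => hn (h.mono he h0 (by norm_num))
  -- The values `1, …, t` and the value `0` of `e` itself all occur inside the triple, which forces
  -- `t + 1` edges there.
  have hsub : ((Finset.range (t + 1) : Finset ℕ) : Set ℕ) ⊆ c '' E(G.induce {x, y, z}) := by
    intro j hj
    rw [Finset.coe_range, Set.mem_Iio] at hj
    rw [edgeSet_induce]
    rcases eq_or_ne j 0 with rfl | hj0
    · exact ⟨e, ⟨x, y, hxy, by simp, by simp⟩, h0⟩
    · rcases hT.colorLink_inside hc hG hxy h0 hj0 (by omega) hn with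
        ⟨f, hf, rfl⟩ | ⟨f, hf, rfl⟩ | ⟨f, hf, rfl⟩
      all_goals exact ⟨f, ⟨_, _, hf, by simp, by simp⟩, rfl⟩
  have hfin : E(G.induce {x, y, z}).Finite := hG.finite_edgeSet.subset fun f hf => by
    rw [edgeSet_induce] at hf
    obtain ⟨_, _, hf, _⟩ := hf
    exact hf.edge_mem
  have h1 := Set.ncard_le_ncard hsub (hfin.image c)
  rw [Set.ncard_coe_finset, Finset.card_range] at h1
  have h2 := Set.ncard_image_le (f := c) hfin
  have h3 := hG.ncard_induce_le x hxy.left_mem y hxy.right_mem z hT.mem (hG.ne_of_isLink hxy)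
    hT.ne_xz hT.ne_yz
  omega

end Graph

namespace Graph

variable {α : Type u} {β : Type v} {G : Graph α β} {t Δ : ℕ} {c : β → ℕ}

/-! ## Coloring all edges -/

theorem isPartialColoring_zero : G.IsPartialColoring t fun _ => 0 :=
  ⟨fun _ _ => t.zero_le, fun _ _ _ _ _ _ h => absurd rfl h⟩

theorem exists_eq_zero_of_coloredCard_lt (h : G.coloredCard c < E(G).ncard) : ∃ e ∈ E(G), c e = 0 := by
  by_contra! h'
  have h'' : {e ∈ E(G) | c e ≠ 0} = E(G) := Set.ext fun e => ⟨fun h => h.1, fun h => ⟨h, h' e h⟩⟩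
  exact h.ne (congrArg Set.ncard h'')

theorem Improvable.exists_coloring [DecidableEq β] {N d : ℕ} (h : G.Improvable t N d c) :
    ∃ c', G.IsPartialColoring t c' ∧ N < G.coloredCard c' := by
  induction d generalizing c with
  | zero => exact ⟨c, h⟩
  | succ d ih => obtain ⟨c', -, h⟩ := h; exact ih h

theorem IsSparse.exists_coloring (hG : G.IsSparse t Δ) :
    ∃ c, G.IsPartialColoring t c ∧ E(G).ncard ≤ G.coloredCard c := by
  classical
  suffices ∀ N ≤ E(G).ncard, ∃ c, G.IsPartialColoring t c ∧ N ≤ G.coloredCard c from this _ le_rfl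
  intro N
  induction N with
  | zero => exact fun _ => ⟨fun _ => 0, isPartialColoring_zero, Nat.zero_le _⟩
  | succ N ih =>
    intro hN
    obtain ⟨c, hc, hNc⟩ := ih (by omega)
    by_cases h : G.coloredCard c < E(G).ncard
    · obtain ⟨e, he, h0⟩ := exists_eq_zero_of_coloredCard_lt h
      obtain ⟨c', hc', h'⟩ := (hc.improvable hG he h0).exists_coloring
      exact ⟨c', hc', by omega⟩
    · exact ⟨c, hc, by omega⟩

/-! ## Removing the smallest color class -/

/-- The number of edges of color `i`. -/
noncomputable def classCard (G : Graph α β) (c : β → ℕ) (i : ℕ) : ℕ := {e ∈ E(G) | c e = i}.ncard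

/-- Uncolor the edges of color `i`, and give this color to the edges of color `k`. -/
def dropColor (c : β → ℕ) (k i : ℕ) : β → ℕ := fun e =>
  if c e = i then 0 else if c e = k then i else c e

theorem dropColor_eq_zero_iff {k i : ℕ} (hk : k ≠ 0) (hi : i ≠ 0) {e : β} :
    dropColor c k i e = 0 ↔ c e = i ∨ c e = 0 := by
  unfold dropColor; split_ifs <;> grind

theorem coloredCard_dropColor (hE : E(G).Finite) {k i : ℕ} (hk : k ≠ 0) (hi : i ≠ 0) :
    G.coloredCard (dropColor c k i) + G.classCard c i = G.coloredCard c := by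
  unfold coloredCard classCard
  rw [← Set.ncard_union_eq _ (hE.subset fun _ h => h.1) (hE.subset fun _ h => h.1)]
  · congr 1
    ext e
    simp only [ne_eq, dropColor_eq_zero_iff hk hi, Set.mem_union, Set.mem_ofPred_eq]
    have : c e = i → ¬ c e = 0 := fun h => h ▸ hi
    tauto
  · rw [Set.disjoint_left]
    rintro e ⟨_, h⟩ ⟨_, h'⟩
    exact h ((dropColor_eq_zero_iff hk hi).2 (Or.inl h'))

theorem IsPartialColoring.dropColor {k i : ℕ} (hc : G.IsPartialColoring (k + 1) c) (hi : i ≤ k + 1) :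
    G.IsPartialColoring k (dropColor c (k + 1) i) where
  le e he := by
    have := hc.le e he
    unfold Graph.dropColor; split_ifs <;> omega
  eq e f x he hf hef h0 := by
    refine hc.eq e f x he hf ?_ ?_ <;>
    · unfold Graph.dropColor at hef h0
      split_ifs at hef h0 <;> omega

theorem sum_classCard (hE : E(G).Finite) {k : ℕ} (hc : G.IsPartialColoring k c) :
    ∑ i ∈ Finset.Icc 1 k, G.classCard c i = G.coloredCard c := by
  classical
  have h1 : ∀ i, G.classCard c i = {e ∈ hE.toFinset | c e = i}.card := fun i => by
    rw [classCard, ← Set.ncard_coe_finset]; simp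
  have h2 : G.coloredCard c = {e ∈ hE.toFinset | c e ≠ 0}.card := by
    rw [coloredCard, ← Set.ncard_coe_finset]; simp
  rw [h2, Finset.card_eq_sum_card_fiberwise (f := c) (t := Finset.Icc 1 k)]
  · refine Finset.sum_congr rfl fun i hi => ?_
    rw [h1, Finset.filter_filter]
    congr 1
    refine Finset.filter_congr fun e _ => ?_
    rw [Finset.mem_Icc] at hi
    omega
  · intro e he
    simp only [Finset.coe_filter, Set.Finite.mem_toFinset, Set.mem_ofPred_eq] at he
    simpa using ⟨Nat.one_le_iff_ne_zero.2 he.2, hc.le e he.1⟩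

/-- If `i` is the smallest color class, removing it does not decrease the share of colored edges per
color. -/
theorem IsPartialColoring.mul_le_dropColor (hE : E(G).Finite) {k i m : ℕ}
    (hc : G.IsPartialColoring (k + 1) c) (hi : i ≠ 0)
    (hmin : ∀ j, j ≠ 0 → j ≤ k + 1 → G.classCard c i ≤ G.classCard c j)
    (h : (k + 1) * m ≤ t * G.coloredCard c) :
    k * m ≤ t * G.coloredCard (Graph.dropColor c (k + 1) i) := by
  have h1 : (k + 1) * G.classCard c i ≤ G.coloredCard c := by
    rw [← sum_classCard hE hc]
    simpa using Finset.card_nsmul_le_sum (Finset.Icc 1 (k + 1)) (G.classCard c) (G.classCard c i)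
      fun j hj => by
        rw [Finset.mem_Icc] at hj
        exact hmin j (by omega) hj.2
  have h2 := coloredCard_dropColor (c := c) hE k.succ_ne_zero hi
  -- The smallest of `k + 1` classes is at most the average, so the fraction `k / (k + 1)` of the
  -- colored edges remains.
  have h3 : k * G.coloredCard c ≤ (k + 1) * G.coloredCard (Graph.dropColor c (k + 1) i) := by
    rw [← h2] at h1 ⊢; nlinarith
  refine Nat.le_of_mul_le_mul_left (?_ : (k + 1) * _ ≤ (k + 1) * _) k.succ_pos
  calc (k + 1) * (k * m) = k * ((k + 1) * m) := by ring
    _ ≤ k * (t * G.coloredCard c) := Nat.mul_le_mul_left _ h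
    _ = t * (k * G.coloredCard c) := by ring
    _ ≤ t * ((k + 1) * G.coloredCard (Graph.dropColor c (k + 1) i)) := Nat.mul_le_mul_left _ h3
    _ = _ := by ring

theorem IsSparse.exists_coloring_of_le (hG : G.IsSparse t Δ) {k : ℕ} (hk : k ≤ t) :
    ∃ c, G.IsPartialColoring k c ∧ k * E(G).ncard ≤ t * G.coloredCard c := by
  induction hk using Nat.decreasingInduction with
  | self =>
    obtain ⟨c, hc, h⟩ := hG.exists_coloring
    exact ⟨c, hc, Nat.mul_le_mul_left _ h⟩
  | of_succ k _ ih =>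
    obtain ⟨c, hc, h⟩ := ih
    obtain ⟨i, hi, hmin⟩ := Finset.exists_min_image (Finset.Icc 1 (k + 1)) (G.classCard c) ⟨1, by simp⟩
    rw [Finset.mem_Icc] at hi
    exact ⟨_, hc.dropColor hi.2, hc.mul_le_dropColor hG.finite_edgeSet (by omega)
      (fun j hj hj' => hmin j (Finset.mem_Icc.2 ⟨by omega, hj'⟩)) h⟩

/-! ## The subgraph of colored edges -/

theorem IsPartialColoring.isEdgeColoring (hc : G.IsPartialColoring t c) :
    (G.restrict {e | c e ≠ 0}).IsEdgeColoring t c := by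
  refine ⟨fun e he => ⟨Nat.one_le_iff_ne_zero.2 he.2, hc.le e he.1⟩, ?_⟩
  rintro e he f hf hne ⟨x, hex, hfx⟩ hef
  exact hne (hc.eq e f x (restrict_inc.1 hex).1 (restrict_inc.1 hfx).1 hef he.2)

theorem div_mul_le_ncard_restrict {k : ℕ} {t : ℤ} (ht : 0 ≤ t)
    (h : k * E(G).ncard ≤ t.toNat * G.coloredCard c) :
    (k : ℝ) / (t : ℝ) * (E(G).ncard : ℝ) ≤ (E(G.restrict {e | c e ≠ 0}).ncard : ℝ) := by
  lift t to ℕ using ht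
  have h1 : E(G.restrict {e | c e ≠ 0}).ncard = G.coloredCard c := rfl
  rw [h1, Int.cast_natCast, div_mul_eq_mul_div]
  -- This form of the division lemma covers `t = 0`, where the quotient is `0`.
  refine div_le_of_le_mul₀ (by positivity) (by positivity) ?_
  rw [mul_comm (G.coloredCard c : ℝ)]
  exact_mod_cast h

end Graph

/-! ### From the hypotheses of the theorem to sparseness -/

namespace IsInstance

variable {α : Type u} {β : Type v} {G : Graph α β} {t : ℤ}

theorem ncard_incidenceSet_le (h : IsInstance G t) {x : α} (hx : x ∈ V(G)) :
    (G.incidenceSet x).ncard ≤ G.maxDegree := by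
  have := h.finite_vertexSet.to_subtype
  exact (Nat.le_add_right _ _).trans
    (le_ciSup (f := fun x : V(G) => G.degree x) (Set.finite_range _).bddAbove ⟨x, hx⟩)

theorem nonneg_and_four_mul_le (h : IsInstance G t) : 0 ≤ t ∧ 4 * (G.maxDegree : ℤ) ≤ 3 * t := by
  -- The value `14 / 3` is the one with `(14 / 3) / 2 - 1 = 4 / 3`; its square `196 / 9` is below
  -- `22`.
  have h1 : (14 / 3 : ℝ) ≤ Real.sqrt 22 := Real.le_sqrt_of_sq_le (by norm_num)
  have h2 := h.ge_mul
  have h3 : (0 : ℝ) ≤ G.maxDegree := Nat.cast_nonneg _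
  have h4 : 4 * (G.maxDegree : ℝ) ≤ 3 * (t : ℝ) := by nlinarith
  have h5 : 4 * (G.maxDegree : ℤ) ≤ 3 * t := by exact_mod_cast h4
  exact ⟨by omega, h5⟩

theorem degree_eq (h : IsInstance G t) (x : α) : G.degree x = (G.incidenceSet x).ncard := by
  have : G.loopSet x = ∅ := Set.eq_empty_iff_forall_notMem.2 fun e => h.loopless.not_isLoopAt e x
  rw [Graph.degree, this, Set.ncard_empty, Nat.add_zero]

theorem maxDegree_le (h : IsInstance G t) : G.maxDegree ≤ E(G).ncard := by
  unfold Graph.maxDegree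
  rcases isEmpty_or_nonempty V(G) with hV | hV
  · simp
  · refine ciSup_le fun x => ?_
    rw [h.degree_eq]
    exact Set.ncard_le_ncard (G.incidenceSet_subset_edgeSet _) h.finite_edgeSet

/-- Needed for the running time: the program loops over colors, so `t` must be bounded in terms of
the input size. -/
theorem toNat_le (h : IsInstance G t) : t.toNat ≤ 2 * E(G).ncard := by
  have h1 := h.maxDegree_le
  have h2 : (t : ℝ) ≤ 3 * (G.maxDegree : ℝ) / 2 :=
    (Int.cast_le.2 h.le_floor).trans (Int.floor_le _)
  have h3 : 2 * (t : ℝ) ≤ 3 * (G.maxDegree : ℝ) := by linarith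
  have h4 : 2 * t ≤ 3 * (G.maxDegree : ℤ) := by exact_mod_cast h3
  omega

theorem isSparse (h : IsInstance G t) : G.IsSparse t.toNat G.maxDegree where
  finite_vertexSet := h.finite_vertexSet
  finite_edgeSet := h.finite_edgeSet
  ne_of_isLink he := by rintro rfl; exact h.loopless.not_isLoopAt _ _ he
  ncard_incidenceSet_le _ := h.ncard_incidenceSet_le
  four_mul_le := by have := h.nonneg_and_four_mul_le; omega
  ncard_induce_le x hx y hy z hz hxy hxz hyz := by
    have h1 := h.three_vertex (G.induce {x, y, z})
      (Graph.induce_le (by rintro u (rfl | rfl | rfl) <;> assumption))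
      (by rw [Graph.vertexSet_induce, Set.ncard_eq_three]; exact ⟨x, y, z, hxy, hxz, hyz, rfl⟩)
    omega

theorem exists_edgeColorable_subgraph (h : IsInstance G t) : ∃ H : Graph α β, H ≤ G ∧
    H.EdgeColorable G.maxDegree ∧
      (G.maxDegree : ℝ) / (t : ℝ) * (E(G).ncard : ℝ) ≤ (E(H).ncard : ℝ) := by
  have h1 := h.nonneg_and_four_mul_le
  obtain ⟨c, hc, hcard⟩ := h.isSparse.exists_coloring_of_le (k := G.maxDegree) (by omega)
  exact ⟨_, Graph.restrict_le, ⟨c, hc.isEdgeColoring⟩, Graph.div_mul_le_ncard_restrict h1.1 hcard⟩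

end IsInstance

namespace RAM

/-! ## Programs with bounded loops -/

@[simp] theorem Store.setReg_arr (s : Store) (i x : ℕ) : (s.setReg i x).arr = s.arr := rfl

@[simp] theorem Store.setArr_reg (s : Store) (a j x : ℕ) : (s.setArr a j x).reg = s.reg := rfl

theorem Store.setReg_reg (s : Store) (i x r : ℕ) :
    (s.setReg i x).reg r = if r = i then x else s.reg r := Function.update_apply ..

@[simp] theorem Store.setReg_reg_self (s : Store) (i x : ℕ) : (s.setReg i x).reg i = x :=
  Function.update_self ..

@[simp] theorem Store.setArr_arr_self (s : Store) (a j x : ℕ) :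
    (s.setArr a j x).arr a = Function.update (s.arr a) j x := Function.update_self ..

theorem Store.setReg_reg_of_ne (s : Store) {i x r : ℕ} (h : r ≠ i) :
    (s.setReg i x).reg r = s.reg r := Function.update_of_ne h ..

theorem Store.setArr_arr_of_ne (s : Store) {a j x b : ℕ} (h : b ≠ a) :
    (s.setArr a j x).arr b = s.arr b := Function.update_of_ne h ..

attribute [simp] Expr.eval

/-- Programs whose only loops are `for`-loops: `loop i b k p` runs `p` with `0, 1, …` in register `i`,
as long as this is less than `k` plus the content of register `b`. -/
inductive Cmd where
  | skip
  | set (i : ℕ) (e : Expr)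
  | put (a : ℕ) (j e : Expr)
  | seq (p q : Cmd)
  | ite (e : Expr) (p q : Cmd)
  | loop (i b k : ℕ) (p : Cmd)

namespace Cmd

/-- Translation to while-programs. -/
def toProg : Cmd → Prog
  | skip => .skip
  | set i e => .set i e
  | put a j e => .put a j e
  | seq p q => .seq p.toProg q.toProg
  | ite e p q => .ite e p.toProg q.toProg
  | loop i b k p => .seq (.set i (.lit 0)) (.loop (.lt (.reg i) (.add (.reg b) (.lit k)))
      (.seq p.toProg (.set i (.add (.reg i) (.lit 1)))))

/-- Iterate `f` with the counter in register `i`. -/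
def iter (f : Store → Store) (i : ℕ) (s : Store) : ℕ → Store
  | 0 => s.setReg i 0
  | j + 1 => (f (iter f i s j)).setReg i (j + 1)

/-- The effect of a program on the memory. -/
def run : Cmd → Store → Store
  | skip, s => s
  | set i e, s => s.setReg i (e.eval s)
  | put a j e, s => s.setArr a (j.eval s) (e.eval s)
  | seq p q, s => q.run (p.run s)
  | ite e p q, s => if e.eval s ≠ 0 then p.run s else q.run s
  | loop i b k p, s => iter p.run i s (s.reg b + k)

/-- The program assigns to register `r`. -/
@[simp] def WritesReg : Cmd → ℕ → Prop
  | skip, _ => False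
  | set i _, r => r = i
  | put _ _ _, _ => False
  | seq p q, r => p.WritesReg r ∨ q.WritesReg r
  | ite _ p q, r => p.WritesReg r ∨ q.WritesReg r
  | loop i _ _ p, r => r = i ∨ p.WritesReg r

/-- The program assigns to array `a`. -/
@[simp] def WritesArr : Cmd → ℕ → Prop
  | skip, _ => False
  | set _ _, _ => False
  | put a' _ _, a => a = a'
  | seq p q, a => p.WritesArr a ∨ q.WritesArr a
  | ite _ p q, a => p.WritesArr a ∨ q.WritesArr a
  | loop _ _ _ p, a => p.WritesArr a

/-- Loop bounds are input registers, input registers are not changed, and loop counters are not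
changed in the body of the loop. -/
@[simp] def Wf : Cmd → Prop
  | skip => True
  | set i _ => 3 ≤ i
  | put _ _ _ => True
  | seq p q => p.Wf ∧ q.Wf
  | ite _ p q => p.Wf ∧ q.Wf
  | loop i b _ p => b < 3 ∧ 3 ≤ i ∧ ¬ p.WritesReg i ∧ p.Wf

/-- A bound for the running time in terms of the sum of the input registers. -/
noncomputable def time : Cmd → Polynomial ℕ
  | skip => 1
  | set _ e => .C (e.cost + 1)
  | put _ j e => .C (j.cost + e.cost + 1)
  | seq p q => p.time + q.time
  | ite e p q => .C (e.cost + 1) + (p.time + q.time)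
  -- A round costs `6` for the guard and `4` for the increment besides the body. The remaining `8`
  -- is `2` for resetting the counter and `6` for the final guard.
  | loop _ _ k p => .C 8 + (.X + .C k) * (p.time + .C 10)

@[simp] theorem run_skip (s : Store) : skip.run s = s := rfl

@[simp] theorem run_set (s : Store) (i : ℕ) (e : Expr) : (set i e).run s = s.setReg i (e.eval s) := rfl

@[simp] theorem run_put (s : Store) (a : ℕ) (j e : Expr) :
    (put a j e).run s = s.setArr a (j.eval s) (e.eval s) := rfl

@[simp] theorem run_seq (s : Store) (p q : Cmd) : (seq p q).run s = q.run (p.run s) := rfl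

@[simp] theorem run_ite (s : Store) (e : Expr) (p q : Cmd) :
    (ite e p q).run s = if e.eval s ≠ 0 then p.run s else q.run s := rfl

theorem run_reg {p : Cmd} {r : ℕ} (h : ¬ p.WritesReg r) (s : Store) : (p.run s).reg r = s.reg r := by
  induction p generalizing s with
  | skip => rfl
  | set i e => exact s.setReg_reg_of_ne h
  | put => rfl
  | seq p q ihp ihq =>
    simp only [WritesReg, not_or] at h
    rw [run_seq, ihq h.2, ihp h.1]
  | ite e p q ihp ihq =>
    simp only [WritesReg, not_or] at h
    rw [run_ite]
    split_ifs
    exacts [ihp h.1 s, ihq h.2 s]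
  | loop i b k p ih =>
    simp only [WritesReg, not_or] at h
    rw [run]
    generalize s.reg b + k = K
    induction K with
    | zero => exact s.setReg_reg_of_ne h.1
    | succ K ihK => rw [iter, Store.setReg_reg_of_ne _ h.1, ih h.2, ihK]

theorem run_arr {p : Cmd} {a : ℕ} (h : ¬ p.WritesArr a) (s : Store) : (p.run s).arr a = s.arr a := by
  induction p generalizing s with
  | skip => rfl
  | set i e => rfl
  | put => exact s.setArr_arr_of_ne h
  | seq p q ihp ihq =>
    simp only [WritesArr, not_or] at h
    rw [run_seq, ihq h.2, ihp h.1]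
  | ite e p q ihp ihq =>
    simp only [WritesArr, not_or] at h
    rw [run_ite]
    split_ifs
    exacts [ihp h.1 s, ihq h.2 s]
  | loop i b k p ih =>
    rw [run]
    generalize s.reg b + k = K
    induction K with
    | zero => rfl
    | succ K ihK => rw [iter, Store.setReg_arr, ih h, ihK]

theorem Wf.not_writesReg {p : Cmd} (h : p.Wf) {r : ℕ} (hr : r < 3) : ¬ p.WritesReg r := by
  induction p with
  | skip => exact id
  | set i e => simp only [Wf, WritesReg] at *; omega
  | put => exact id
  | seq p q ihp ihq => exact not_or.2 ⟨ihp h.1, ihq h.2⟩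
  | ite e p q ihp ihq => exact not_or.2 ⟨ihp h.1, ihq h.2⟩
  | loop i b k p ih =>
    simp only [Wf] at h
    exact not_or.2 ⟨by omega, ih h.2.2.2⟩

/-- Rule for `for`-loops: an invariant, parametrized by the number of rounds, is proved with the
knowledge that everything the loop does not write to is unchanged. -/
theorem run_loop {i b k : ℕ} {p : Cmd} {s : Store} (I : ℕ → Store → Prop) (h0 : I 0 (s.setReg i 0))
    (hstep : ∀ j < s.reg b + k, ∀ s', (∀ r, ¬ (loop i b k p).WritesReg r → s'.reg r = s.reg r) →
      (∀ a, ¬ p.WritesArr a → s'.arr a = s.arr a) → s'.reg i = j → I j s' →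
      I (j + 1) ((p.run s').setReg i (j + 1))) :
    I (s.reg b + k) ((loop i b k p).run s) := by
  rw [run]
  have key : ∀ j ≤ s.reg b + k, (∀ r, ¬ (loop i b k p).WritesReg r → (iter p.run i s j).reg r = s.reg r) ∧
      (∀ a, ¬ p.WritesArr a → (iter p.run i s j).arr a = s.arr a) ∧
      (iter p.run i s j).reg i = j ∧ I j (iter p.run i s j) := by
    intro j
    induction j with
    | zero =>
      refine fun _ => ⟨fun r hr => ?_, fun _ _ => rfl, s.setReg_reg_self i 0, h0⟩
      simp only [WritesReg, not_or] at hr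
      exact s.setReg_reg_of_ne hr.1
    | succ j ih =>
      intro hj
      obtain ⟨h1, h2, h3, h4⟩ := ih (by omega)
      refine ⟨fun r hr => ?_, fun a ha => ?_, Store.setReg_reg_self .., hstep j hj _ h1 h2 h3 h4⟩
      · rw [← h1 r hr]
        simp only [WritesReg, not_or] at hr
        rw [iter, Store.setReg_reg_of_ne _ hr.1, run_reg hr.2]
      · rw [← h2 a ha, iter, Store.setReg_arr, run_arr ha]
  exact (key _ le_rfl).2.2.2

/-- The translated program has the expected effect, in polynomial time. -/
theorem Wf.runs {p : Cmd} (h : p.Wf) (s : Store) : ∃ T,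
    p.toProg.Runs s T (p.run s) ∧ T ≤ p.time.eval (s.reg 0 + s.reg 1 + s.reg 2) := by
  induction p generalizing s with
  | skip => exact ⟨_, .skip s, by simp [time]⟩
  | set i e => exact ⟨_, .set s i e, by simp [time]⟩
  | put a j e => exact ⟨_, .put s a j e, by simp [time]⟩
  | seq p q ihp ihq =>
    obtain ⟨T, hT, hTt⟩ := ihp h.1 s
    obtain ⟨T', hT', hTt'⟩ := ihq h.2 (p.run s)
    refine ⟨_, .seq hT hT', ?_⟩
    rw [run_reg (h.1.not_writesReg (by norm_num)), run_reg (h.1.not_writesReg (by norm_num)),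
      run_reg (h.1.not_writesReg (by norm_num))] at hTt'
    simp only [time, Polynomial.eval_add]
    omega
  | ite e p q ihp ihq =>
    simp only [time, Polynomial.eval_add, Polynomial.eval_C, run_ite]
    by_cases he : e.eval s = 0
    · obtain ⟨T, hT, hTt⟩ := ihq h.2 s
      exact ⟨_, .iteFalse he (by rwa [if_neg (not_not.2 he)]), by omega⟩
    · obtain ⟨T, hT, hTt⟩ := ihp h.1 s
      exact ⟨_, .iteTrue he (by rwa [if_pos he]), by omega⟩
  | loop i b k p ih =>
    have hw := fun r hr => Wf.not_writesReg h (r := r) hr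
    obtain ⟨hb, hi, hpi, hp⟩ := h
    set L := s.reg 0 + s.reg 1 + s.reg 2 with hL
    have hreg : ∀ r < 3, ∀ j, (iter p.run i s j).reg r = s.reg r := by
      intro r hr j
      induction j with
      | zero => exact s.setReg_reg_of_ne (by omega)
      | succ j ihj => rw [iter, Store.setReg_reg_of_ne _ (by omega), run_reg (hp.not_writesReg hr), ihj]
    have hctr : ∀ j, (iter p.run i s j).reg i = j := by
      intro j
      cases j <;> exact Store.setReg_reg_self ..
    -- Induction on the number `d` of rounds still to be run, since the while-loop unfolds from its
    -- first round.
    have key : ∀ d j, j + d = s.reg b + k → ∃ T,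
        (Prog.loop (.lt (.reg i) (.add (.reg b) (.lit k)))
          (.seq p.toProg (.set i (.add (.reg i) (.lit 1))))).Runs
          (iter p.run i s j) T (iter p.run i s (s.reg b + k)) ∧
        T ≤ d * (p.time.eval L + 10) + 6 := by
      intro d
      induction d with
      | zero =>
        rintro j rfl
        refine ⟨_, .loopDone ?_, ?_⟩
        · simp [hreg b hb, hctr]
        · simp [Expr.cost]
      | succ d ihd =>
        intro j hj
        obtain ⟨T, hT, hTt⟩ := ih hp (iter p.run i s j)
        rw [hreg 0 (by norm_num), hreg 1 (by norm_num), hreg 2 (by norm_num), ← hL] at hTt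
        obtain ⟨T', hT', hTt'⟩ := ihd (j + 1) (by omega)
        refine ⟨_, .loopStep ?_ (.seq hT (.set _ i _)) (?_ : Prog.Runs _ _ T' _), ?_⟩
        · simp [hreg b hb, hctr]; omega
        · convert hT' using 1
          rw [iter]
          simp [run_reg hpi, hctr]
        · simp only [Expr.cost]
          rw [add_mul]
          omega
    obtain ⟨T, hT, hTt⟩ := key _ 0 (Nat.zero_add _)
    refine ⟨_, .seq (.set s i (.lit 0)) hT, ?_⟩
    have hbL : s.reg b ≤ L := by interval_cases b <;> omega
    simp only [time, Polynomial.eval_add, Polynomial.eval_mul, Polynomial.eval_C, Polynomial.eval_X,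
      Expr.cost]
    have := Nat.mul_le_mul_right (p.time.eval L + 10) (Nat.add_le_add_right hbL k)
    omega

/-- A loop that replaces each entry of an array independently. -/
theorem run_loop_map {i b a : ℕ} {p : Cmd} {s : Store} (f : ℕ → ℕ → ℕ)
    (hstep : ∀ j < s.reg b, ∀ s', (∀ r, ¬ (loop i b 0 p).WritesReg r → s'.reg r = s.reg r) →
      (∀ a, ¬ p.WritesArr a → s'.arr a = s.arr a) → s'.reg i = j →
      (p.run s').arr a = Function.update (s'.arr a) j (f j (s'.arr a j))) :
    ((loop i b 0 p).run s).arr a = fun e => if e < s.reg b then f e (s.arr a e) else s.arr a e := by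
  refine run_loop (fun j s' => s'.arr a = fun e => if e < j then f e (s.arr a e) else s.arr a e)
    (by simp) fun j hj s' h1 h2 h3 h4 => ?_
  rw [Store.setReg_arr, hstep j hj s' h1 h2 h3, h4]
  ext e
  rcases lt_trichotomy e j with h | rfl | h
  · simp [h.ne, h, h.trans (Nat.lt_succ_self j)]
  · simp
  · simp [h.ne', h.not_gt, show ¬ e < j + 1 by omega]

/-- A loop that counts in register `r`. -/
theorem run_loop_count {i b r : ℕ} {p : Cmd} {s : Store} (P : ℕ → Prop) [DecidablePred P]
    (hr : r ≠ i) (h0 : s.reg r = 0)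
    (hstep : ∀ j < s.reg b, ∀ s', (∀ r, ¬ (loop i b 0 p).WritesReg r → s'.reg r = s.reg r) →
      (∀ a, ¬ p.WritesArr a → s'.arr a = s.arr a) → s'.reg i = j →
      (p.run s').reg r = s'.reg r + if P j then 1 else 0) :
    ((loop i b 0 p).run s).reg r = Nat.count P (s.reg b) := by
  refine run_loop (fun j s' => s'.reg r = Nat.count P j)
    (by simp [Store.setReg_reg_of_ne _ hr, h0]) fun j hj s' h1 h2 h3 h4 => ?_
  rw [Store.setReg_reg_of_ne _ hr, hstep j hj s' h1 h2 h3, h4, Nat.count_succ]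

end Cmd

end RAM

namespace Graph

variable {α : Type u} {β : Type v} {G : Graph α β} {t : ℕ} {c c' : β → ℕ}

/-! ## Dependence on the colors of the edges only -/

theorem IsPartialColoring.congr (hc : G.IsPartialColoring t c) (h : ∀ e ∈ E(G), c' e = c e) :
    G.IsPartialColoring t c' where
  le e he := h e he ▸ hc.le e he
  eq e f x he hf hef h0 := by
    rw [h e he.edge_mem] at hef h0
    rw [h f hf.edge_mem] at hef
    exact hc.eq e f x he hf hef h0

theorem coloredCard_congr (h : ∀ e ∈ E(G), c' e = c e) : G.coloredCard c' = G.coloredCard c :=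
  congrArg Set.ncard (Set.ext fun e => and_congr_right fun he => by rw [h e he])

theorem kempe_congr (h : ∀ e ∈ E(G), c' e = c e) {x : α} {i j : ℕ} :
    ∀ e ∈ E(G), G.kempe c' x i j e = G.kempe c x i j e := by
  intro e he
  unfold kempe
  rw [Chain.congr fun e he => by rw [h e he]; exact ⟨Iff.rfl, Iff.rfl⟩, h e he]

/-- Arrays in memory match the intended coloring on the edges only, so improvability must not depend
on other values. -/
theorem Improvable.congr [DecidableEq β] {N d : ℕ} (hi : G.Improvable t N d c)
    (h : ∀ e ∈ E(G), c' e = c e) : G.Improvable t N d c' := by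
  induction d generalizing c c' with
  | zero => exact ⟨hi.1.congr h, (coloredCard_congr h).symm ▸ hi.2⟩
  | succ d ih =>
    obtain ⟨_, ⟨e, he, k, hk, x, hx, i, hi, j, hj, rfl⟩, hd⟩ := hi
    refine ⟨_, ⟨e, he, k, hk, x, hx, i, hi, j, hj, rfl⟩, ih hd (kempe_congr fun f hf => ?_)⟩
    simp only [Function.update_apply, h f hf]

theorem Chain.mem_of_closed {i j : ℕ} {S : α → Prop} {x u : α} (hx : S x)
    (hS : ∀ e y z, G.IsLink e y z → (c e = i ∨ c e = j) → S y → S z) (h : G.Chain c i j x u) : S u := by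
  induction h with
  | refl => exact hx
  | tail _ h ih =>
    rcases h with ⟨e, he, h⟩ | ⟨e, he, h⟩
    exacts [hS e _ _ he (Or.inl h) ih, hS e _ _ he (Or.inr h) ih]

end Graph

/-! ### The multigraph in memory -/

namespace RAM

open Cmd

/-- The memory contains the multigraph `G` and the number `t` as input. -/
structure Holds (G : Graph ℕ ℕ) (t : ℕ) (s : Store) : Prop where
  vertexSet : V(G) = {x | x < s.reg 0}
  edgeSet : E(G) = {e | e < s.reg 1}
  isLink : ∀ e < s.reg 1, G.IsLink e (s.arr 0 e) (s.arr 1 e)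
  reg_two : s.reg 2 = t

namespace Holds

variable {G : Graph ℕ ℕ} {t : ℕ} {s s' : Store}

theorem of_eq (h : Holds G t s) (hr : ∀ r < 3, s'.reg r = s.reg r) (ha : ∀ a < 2, s'.arr a = s.arr a) :
    Holds G t s' := by
  obtain ⟨h1, h2, h3, h4⟩ := h
  constructor <;> simp only [hr, ha, show 0 < 3 by norm_num, show 1 < 3 by norm_num,
    show 2 < 3 by norm_num, show 0 < 2 by norm_num, show 1 < 2 by norm_num]
  exacts [h1, h2, h3, h4]

theorem run (h : Holds G t s) {p : Cmd} (hp : p.Wf) (h0 : ¬ p.WritesArr 0) (h1 : ¬ p.WritesArr 1) :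
    Holds G t (p.run s) :=
  h.of_eq (fun _ hr => run_reg (hp.not_writesReg hr) s)
    (fun a ha => run_arr (by interval_cases a <;> assumption) s)

theorem setReg (h : Holds G t s) {i x : ℕ} (hi : 3 ≤ i) : Holds G t (s.setReg i x) :=
  h.of_eq (fun r hr => s.setReg_reg_of_ne (by omega)) fun _ _ => rfl

theorem mem_edgeSet (h : Holds G t s) {e : ℕ} : e ∈ E(G) ↔ e < s.reg 1 := by rw [h.edgeSet]; rfl

theorem mem_vertexSet (h : Holds G t s) {x : ℕ} : x ∈ V(G) ↔ x < s.reg 0 := by rw [h.vertexSet]; rfl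

theorem inc_iff (h : Holds G t s) {e x : ℕ} (he : e < s.reg 1) :
    G.Inc e x ↔ s.arr 0 e = x ∨ s.arr 1 e = x := by
  have hl := h.isLink e he
  constructor
  · intro hx
    rcases hx.eq_or_eq_of_isLink hl with rfl | rfl <;> simp
  · rintro (rfl | rfl)
    exacts [hl.inc_left, hl.inc_right]

theorem ncard_sep (h : Holds G t s) (P : ℕ → Prop) [DecidablePred P] :
    {e ∈ E(G) | P e}.ncard = Nat.count P (s.reg 1) := by
  rw [Nat.count_eq_card_filter_range, ← Set.ncard_coe_finset, h.edgeSet]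
  simp

theorem ncard_edgeSet (h : Holds G t s) : E(G).ncard = s.reg 1 := by
  rw [h.edgeSet, ← Finset.card_range (s.reg 1), ← Set.ncard_coe_finset]
  simp [Set.Iio_def]

end Holds

/-! ## Copying and counting -/

/-- Copy the first entries of array `a` to array `b`, one for each edge. -/
def copy (a b : ℕ) : Cmd := loop 4 1 0 (put b (.reg 4) (.get a (.reg 4)))

theorem copy_run {a b : ℕ} (hab : a ≠ b) (s : Store) {e : ℕ} (he : e < s.reg 1) :
    ((copy a b).run s).arr b e = s.arr a e := by
  unfold copy
  rw [run_loop_map (fun e _ => s.arr a e)]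
  · simp [he]
  · intro j _ s' _ h2 h3
    simp [h3, h2 a (by simpa using hab)]

/-- Count the edges with nonzero entry in array `a`. -/
def count (a r : ℕ) : Cmd := seq (set r (.lit 0))
  (loop 4 1 0 (ite (.get a (.reg 4)) (set r (.add (.reg r) (.lit 1))) skip))

theorem count_run {G : Graph ℕ ℕ} {t : ℕ} {s : Store} (h : Holds G t s) {a r : ℕ} (hr : 4 < r ∨ r = 3) :
    ((count a r).run s).reg r = G.coloredCard (s.arr a) := by
  unfold count
  rw [run_seq, run_loop_count (fun e => s.arr a e ≠ 0) (by omega) (by simp)]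
  · rw [Graph.coloredCard, h.ncard_sep]
    simp [Store.setReg_reg_of_ne _ (show 1 ≠ r by omega)]
  · intro j _ s' _ h2 h3
    rw [run_ite, Expr.eval, Expr.eval, h3, h2 a (by simp), run_set, Store.setReg_arr]
    split_ifs <;> simp

/-! ## Kempe exchanges -/

/-- Programs express a disjunction of tests as the sum of their values. -/
theorem ite_add_ite_ne_zero (p q : Prop) [Decidable p] [Decidable q] :
    (if p then 1 else 0) + (if q then 1 else 0) ≠ 0 ↔ p ∨ q := by
  split_ifs <;> simp_all

theorem ite_one_zero_ne_zero (p : Prop) [Decidable p] : (if p then 1 else 0) ≠ 0 ↔ p := by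
  split_ifs <;> simp_all

/-- Mark, in array `3`, the ends of the edges in the colors given by registers `i` and `j` of the
coloring in array `a` that have a marked end. -/
def markRound (a i j : ℕ) : Cmd :=
  loop 5 1 0 (ite (.add (.eq (.get a (.reg 5)) (.reg i)) (.eq (.get a (.reg 5)) (.reg j)))
    (ite (.add (.get 3 (.get 0 (.reg 5))) (.get 3 (.get 1 (.reg 5))))
      (seq (put 3 (.get 0 (.reg 5)) (.lit 1)) (put 3 (.get 1 (.reg 5)) (.lit 1))) skip) skip)

/-- Soundness, monotonicity and progress of one round. Marks set early in the round may already
spread further within it, so the result is only bounded from both sides. -/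
theorem markRound_run {G : Graph ℕ ℕ} {t : ℕ} {s : Store} (h : Holds G t s) {a i j x : ℕ} (ha : 3 < a)
    (hi : 5 < i) (hj : 5 < j)
    (hs : ∀ u ∈ V(G), s.arr 3 u ≠ 0 → G.Chain (s.arr a) (s.reg i) (s.reg j) x u) :
    (∀ u ∈ V(G), ((markRound a i j).run s).arr 3 u ≠ 0 →
      G.Chain (s.arr a) (s.reg i) (s.reg j) x u) ∧
    (∀ u, s.arr 3 u ≠ 0 → ((markRound a i j).run s).arr 3 u ≠ 0) ∧
    ∀ e y z, G.IsLink e y z → (s.arr a e = s.reg i ∨ s.arr a e = s.reg j) → s.arr 3 y ≠ 0 →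
      ((markRound a i j).run s).arr 3 z ≠ 0 := by
  have key := run_loop (i := 5) (b := 1) (k := 0)
    (p := (ite (.add (.eq (.get a (.reg 5)) (.reg i)) (.eq (.get a (.reg 5)) (.reg j)))
    (ite (.add (.get 3 (.get 0 (.reg 5))) (.get 3 (.get 1 (.reg 5))))
      (seq (put 3 (.get 0 (.reg 5)) (.lit 1)) (put 3 (.get 1 (.reg 5)) (.lit 1))) skip) skip)) (s := s)
    (fun k s' => (∀ u ∈ V(G), s'.arr 3 u ≠ 0 → G.Chain (s.arr a) (s.reg i) (s.reg j) x u) ∧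
      (∀ u, s.arr 3 u ≠ 0 → s'.arr 3 u ≠ 0) ∧
      ∀ e < k, ∀ y z, G.IsLink e y z → (s.arr a e = s.reg i ∨ s.arr a e = s.reg j) → s.arr 3 y ≠ 0 →
        s'.arr 3 z ≠ 0) ⟨hs, fun _ h => h, fun _ h => absurd h (Nat.not_lt_zero _)⟩ ?_
  · refine ⟨key.1, key.2.1, fun e y z he => key.2.2 e ?_ y z he⟩
    exact h.mem_edgeSet.1 he.edge_mem
  · rintro k hk s' h1 h2 h3 ⟨i1, i2, i3⟩
    have hl := h.isLink k hk
    rw [Store.setReg_arr]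
    have e1 : s'.arr a = s.arr a := h2 a (by simp; omega)
    have e2 : s'.arr 0 = s.arr 0 := h2 0 (by simp)
    have e3 : s'.arr 1 = s.arr 1 := h2 1 (by simp)
    have e4 : s'.reg i = s.reg i := h1 i (by simp; omega)
    have e5 : s'.reg j = s.reg j := h1 j (by simp; omega)
    simp only [run_ite, run_seq, run_put, run_skip, Expr.eval, h3, Store.setArr_reg, e1, e2, e3, e4, e5,
      ite_add_ite_ne_zero,
      Store.setArr_arr_of_ne _ (show (1 : ℕ) ≠ 3 by norm_num)]
    have hend : ∀ y z, G.IsLink k y z →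
        (s.arr 0 k = y ∧ s.arr 1 k = z) ∨ (s.arr 0 k = z ∧ s.arr 1 k = y) := fun y z he =>
      hl.eq_and_eq_or_eq_and_eq he
    have hle : ∀ e, e < k + 1 → e < k ∨ e = k := fun e he => by omega
    split_ifs with hcol hm
    · simp only [Store.setArr_arr_self, Function.update_apply]
      refine ⟨fun u hu h0 => ?_, fun u hu => ?_, fun e he y z hyz hcol' hy => ?_⟩
      · have hor : s'.arr 3 (s.arr 0 k) ≠ 0 ∨ s'.arr 3 (s.arr 1 k) ≠ 0 := by omega
        have hboth : G.Chain (s.arr a) (s.reg i) (s.reg j) x (s.arr 0 k) ∧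
            G.Chain (s.arr a) (s.reg i) (s.reg j) x (s.arr 1 k) := by
          rcases hor with h' | h'
          · exact ⟨i1 _ hl.left_mem h', (i1 _ hl.left_mem h').of_isLink hl hcol⟩
          · exact ⟨(i1 _ hl.right_mem h').of_isLink hl.symm hcol, i1 _ hl.right_mem h'⟩
        split_ifs at h0 with hu1 hu2
        exacts [hu1 ▸ hboth.2, hu2 ▸ hboth.1, i1 u hu h0]
      · split_ifs
        exacts [one_ne_zero, one_ne_zero, i2 u hu]
      · rcases hle e he with he | rfl
        · split_ifs
          exacts [one_ne_zero, one_ne_zero, i3 e he y z hyz hcol' hy]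
        · rcases hend y z hyz with ⟨-, rfl⟩ | ⟨rfl, -⟩ <;> simp
    · refine ⟨i1, i2, fun e he y z hyz hcol' hy => ?_⟩
      rcases hle e he with he | rfl
      · exact i3 e he y z hyz hcol' hy
      · have := i2 y hy
        rcases hend y z hyz with ⟨rfl, -⟩ | ⟨-, rfl⟩ <;> omega
    · refine ⟨i1, i2, fun e he y z hyz hcol' hy => ?_⟩
      rcases hle e he with he | rfl
      · exact i3 e he y z hyz hcol' hy
      · exact absurd hcol' hcol

/-- Mark, in array `3`, the component of the vertex in register `v` in the subgraph formed by the
colors in registers `i` and `j` of the coloring in array `a`. -/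
def mark (a v i j : ℕ) : Cmd :=
  seq (loop 4 0 0 (put 3 (.reg 4) (.lit 0))) (seq (put 3 (.reg v) (.lit 1))
    (loop 4 0 0 (markRound a i j)))

/-- As long as the marked set does not contain the whole component, some link leads out of it and
the next round marks a new vertex. After `r` rounds the component is fully marked or at least `r +
1` vertices are marked, and the latter fails once `r` is the number of vertices. -/
theorem mark_run {G : Graph ℕ ℕ} {t : ℕ} {s : Store} (h : Holds G t s) {a v i j : ℕ} (ha : 3 < a)
    (hv : 5 < v) (hi : 5 < i) (hj : 5 < j) (hvV : s.reg v ∈ V(G)) {u : ℕ} (hu : u ∈ V(G)) :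
    ((mark a v i j).run s).arr 3 u ≠ 0 ↔ G.Chain (s.arr a) (s.reg i) (s.reg j) (s.reg v) u := by
  unfold mark
  rw [run_seq, run_seq]
  set s₁ := (loop 4 0 0 (put 3 (.reg 4) (.lit 0))).run s with hs₁
  set s₂ := (put 3 (.reg v) (.lit 1)).run s₁ with hs₂
  have hs₁3 : s₁.arr 3 = fun e => if e < s.reg 0 then 0 else s.arr 3 e :=
    run_loop_map (fun _ _ => 0) fun j _ s' _ _ h3 => by simp [h3]
  have hreg : ∀ r, r ≠ 4 → s₂.reg r = s.reg r := fun r hr => run_reg (by simpa using hr) s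
  have harr : ∀ r, r ≠ 3 → s₂.arr r = s.arr r := fun r hr => by
    rw [hs₂, run_put, Store.setArr_arr_of_ne _ hr, hs₁, run_arr (by simpa using hr)]
  have h2 : Holds G t s₂ := h.of_eq (fun r hr => hreg r (by omega)) fun a ha => harr a (by omega)
  have hs₂3 : ∀ w ∈ V(G), (s₂.arr 3 w ≠ 0 ↔ w = s.reg v) := by
    intro w hw
    rw [hs₂, run_put, Store.setArr_arr_self, Expr.eval, Expr.eval, hs₁, run_reg (by simp; omega), ← hs₁,
      hs₁3]
    simp only [Function.update_apply, h.mem_vertexSet.1 hw, if_true]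
    split_ifs with h1 <;> simp [h1]
  rw [← harr a (by omega), ← hreg i (by omega), ← hreg j (by omega), ← hreg v (by omega)] at *
  clear_value s₁ s₂
  clear hs₁ hs₂ hs₁3
  have hn : s₂.reg 0 + 0 = s₂.reg 0 := rfl
  have key := run_loop (i := 4) (b := 0) (k := 0) (p := markRound a i j) (s := s₂)
    (fun r s' => (∀ w ∈ V(G), s'.arr 3 w ≠ 0 →
        G.Chain (s₂.arr a) (s₂.reg i) (s₂.reg j) (s₂.reg v) w) ∧ s'.arr 3 (s₂.reg v) ≠ 0 ∧
      ((∀ w ∈ V(G), G.Chain (s₂.arr a) (s₂.reg i) (s₂.reg j) (s₂.reg v) w → s'.arr 3 w ≠ 0) ∨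
        r + 1 ≤ ((Finset.range (s₂.reg 0)).filter (s'.arr 3 · ≠ 0)).card)) ?_ ?_
  · obtain ⟨k1, k2, k3⟩ := key
    refine ⟨k1 u hu, ?_⟩
    rcases k3 with k3 | k3
    · exact k3 u hu
    · have := k3.trans (Finset.card_filter_le _ _)
      rw [Finset.card_range] at this
      omega
  · refine ⟨fun w hw h0 => (hs₂3 w hw).1 h0 ▸ .refl, (hs₂3 _ hvV).2 rfl, Or.inr ?_⟩
    exact Finset.card_pos.2 ⟨s₂.reg v, Finset.mem_filter.2
      ⟨Finset.mem_range.2 (h2.mem_vertexSet.1 hvV), (hs₂3 _ hvV).2 rfl⟩⟩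
  · rintro r hr s' f1 f2 f3 ⟨i1, i2, i3⟩
    rw [Store.setReg_arr]
    have e1 : s'.arr a = s₂.arr a := f2 a (by simp [markRound]; omega)
    have e2 : s'.reg i = s₂.reg i := f1 i (by simp [markRound]; omega)
    have e3 : s'.reg j = s₂.reg j := f1 j (by simp [markRound]; omega)
    have h' : Holds G t s' := h2.of_eq (fun r hr => f1 r (by simp [markRound]; omega))
      (fun a ha => f2 a (by simp [markRound]; omega))
    obtain ⟨m1, m2, m3⟩ := markRound_run h' (a := a) ha hi hj (x := s₂.reg v)
      (by rw [e1, e2, e3]; exact i1)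
    rw [e1, e2, e3] at m1 m3
    refine ⟨m1, m2 _ i2, ?_⟩
    by_cases hcl : ∀ w ∈ V(G), G.Chain (s₂.arr a) (s₂.reg i) (s₂.reg j) (s₂.reg v) w → s'.arr 3 w ≠ 0
    · exact Or.inl fun w hw hch => m2 w (hcl w hw hch)
    · right
      have i3 := i3.resolve_left hcl
      obtain ⟨y, z, e, he, hcol, hy, hz⟩ : ∃ y z e, G.IsLink e y z ∧
          (s₂.arr a e = s₂.reg i ∨ s₂.arr a e = s₂.reg j) ∧ s'.arr 3 y ≠ 0 ∧ s'.arr 3 z = 0 := by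
        by_contra! hcon
        exact hcl fun w _ hch => hch.mem_of_closed (S := fun w => s'.arr 3 w ≠ 0) i2
          fun e y z he hcol hy => hcon y z e he hcol hy
      refine Nat.succ_le_of_lt (i3.trans_lt (Finset.card_lt_card
        ((Finset.ssubset_iff_of_subset fun w hw => ?_).2 ⟨z, ?_, ?_⟩)))
      · rw [Finset.mem_filter] at hw ⊢
        exact ⟨hw.1, m2 w hw.2⟩
      · exact Finset.mem_filter.2 ⟨Finset.mem_range.2 (h2.mem_vertexSet.1 he.right_mem),
          m3 e y z he hcol hy⟩
      · exact fun hz' => (Finset.mem_filter.1 hz').2 hz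

/-- Exchange the colors in registers `i` and `j` on the edges with a marked end, in the coloring in
array `a`. -/
def swapMarked (a i j : ℕ) : Cmd :=
  loop 4 1 0 (ite (.add (.get 3 (.get 0 (.reg 4))) (.get 3 (.get 1 (.reg 4))))
    (ite (.eq (.get a (.reg 4)) (.reg i)) (put a (.reg 4) (.reg j))
      (ite (.eq (.get a (.reg 4)) (.reg j)) (put a (.reg 4) (.reg i)) skip)) skip)

theorem swapMarked_run {s : Store} {a i j : ℕ} (ha : 3 < a) (hi : 5 < i) (hj : 5 < j) {e : ℕ}
    (he : e < s.reg 1) : ((swapMarked a i j).run s).arr a e =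
      if s.arr 3 (s.arr 0 e) ≠ 0 ∨ s.arr 3 (s.arr 1 e) ≠ 0
      then Equiv.swap (s.reg i) (s.reg j) (s.arr a e) else s.arr a e := by
  unfold swapMarked
  rw [run_loop_map fun e k => if s.arr 3 (s.arr 0 e) ≠ 0 ∨ s.arr 3 (s.arr 1 e) ≠ 0
      then Equiv.swap (s.reg i) (s.reg j) k else k]
  · simp only [he, if_true]
  · intro k hk s' h1 h2 h3
    have e0 : s'.arr 3 = s.arr 3 := h2 3 (by simp; omega)
    have e2 : s'.arr 0 = s.arr 0 := h2 0 (by simp; omega)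
    have e3 : s'.arr 1 = s.arr 1 := h2 1 (by simp; omega)
    have e4 : s'.reg i = s.reg i := h1 i (by simp; omega)
    have e5 : s'.reg j = s.reg j := h1 j (by simp; omega)
    simp only [run_ite, run_put, run_skip, Expr.eval, h3, e0, e2, e3, e4, e5, Equiv.swap_apply_def]
    have hor : s.arr 3 (s.arr 0 k) + s.arr 3 (s.arr 1 k) ≠ 0 ↔
        (s.arr 3 (s.arr 0 k) ≠ 0 ∨ s.arr 3 (s.arr 1 k) ≠ 0) := by omega
    rw [if_congr hor rfl rfl]
    split_ifs <;> simp_all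

end RAM

namespace RAM

open Cmd

variable {G : Graph ℕ ℕ} {t N : ℕ} {s : Store}

/-! ## Exhaustive search for an improvement -/

/-- Perform one recoloring step on the coloring in array `5 + d`, with parameters in the registers
`20 + 5 * d, …, 24 + 5 * d`, and store the result in array `4 + d`. -/
def recolor (d : ℕ) : Cmd :=
  seq (copy (5 + d) (4 + d)) (seq (put (4 + d) (.reg (20 + 5 * d)) (.reg (21 + 5 * d)))
    (seq (mark (4 + d) (22 + 5 * d) (23 + 5 * d) (24 + 5 * d))
      (swapMarked (4 + d) (23 + 5 * d) (24 + 5 * d))))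

theorem recolor_writesReg {d r : ℕ} (h : (recolor d).WritesReg r) : r = 4 ∨ r = 5 := by
  simp [recolor, copy, mark, markRound, swapMarked] at h; omega

theorem recolor_writesArr {d a : ℕ} (h : (recolor d).WritesArr a) : a = 3 ∨ a = 4 + d := by
  simp [recolor, copy, mark, markRound, swapMarked] at h; omega

theorem recolor_wf (d : ℕ) : (recolor d).Wf := by
  simp [recolor, copy, mark, markRound, swapMarked]

theorem recolor_run (h : Holds G t s) {d : ℕ}
    (hv : s.reg (22 + 5 * d) ∈ V(G)) {f : ℕ} (hf : f ∈ E(G)) :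
    ((recolor d).run s).arr (4 + d) f = G.kempe (Function.update (s.arr (5 + d)) (s.reg (20 + 5 * d))
      (s.reg (21 + 5 * d))) (s.reg (22 + 5 * d)) (s.reg (23 + 5 * d)) (s.reg (24 + 5 * d)) f := by
  have hcopy := fun f (hf : f < s.reg 1) => copy_run (show 5 + d ≠ 4 + d by omega) s hf
  unfold recolor
  simp only [run_seq]
  set s₁ := (copy (5 + d) (4 + d)).run s with hs₁
  have hr₁ : ∀ r, r ≠ 4 → s₁.reg r = s.reg r := fun r hr => run_reg (by simpa [copy] using hr) s
  have ha₁ : ∀ a, a ≠ 4 + d → s₁.arr a = s.arr a := fun r hr => run_arr (by simpa [copy] using hr) s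
  set s₂ := (put (4 + d) (.reg (20 + 5 * d)) (.reg (21 + 5 * d))).run s₁ with hs₂
  have hr₂ : ∀ r, r ≠ 4 → s₂.reg r = s.reg r := fun r hr => hr₁ r hr
  have ha₂ : ∀ a, a ≠ 4 + d → s₂.arr a = s.arr a := fun a ha => by
    rw [hs₂, run_put, Store.setArr_arr_of_ne _ ha, ha₁ a ha]
  have h2 : Holds G t s₂ := h.of_eq (fun r hr => hr₂ r (by omega)) fun a ha => ha₂ a (by omega)
  have hcol : ∀ f ∈ E(G), s₂.arr (4 + d) f = Function.update (s.arr (5 + d)) (s.reg (20 + 5 * d))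
      (s.reg (21 + 5 * d)) f := by
    intro f hf
    rw [hs₂, run_put, Store.setArr_arr_self, Expr.eval, Expr.eval, hr₁ _ (by omega), hr₁ _ (by omega),
      Function.update_apply, Function.update_apply, hcopy f (h.mem_edgeSet.1 hf)]
  rw [← Graph.kempe_congr hcol f hf, ← hr₂ (22 + 5 * d) (by omega), ← hr₂ (23 + 5 * d) (by omega),
    ← hr₂ (24 + 5 * d) (by omega)]
  rw [← hr₂ (22 + 5 * d) (by omega)] at hv
  clear_value s₂
  have hmark := fun u hu => mark_run h2 (a := 4 + d) (v := 22 + 5 * d) (i := 23 + 5 * d)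
    (j := 24 + 5 * d) (by omega) (by omega) (by omega) (by omega) hv (u := u) hu
  set s₃ := (mark (4 + d) (22 + 5 * d) (23 + 5 * d) (24 + 5 * d)).run s₂ with hs₃
  have hr₃ : ∀ r, r ≠ 4 → r ≠ 5 → s₃.reg r = s₂.reg r := fun r hr hr' =>
    run_reg (by simp [mark, markRound]; omega) s₂
  have ha₃ : ∀ a, a ≠ 3 → s₃.arr a = s₂.arr a := fun a ha =>
    run_arr (by simp [mark, markRound]; omega) s₂
  have hf' := h2.mem_edgeSet.1 hf
  have hl := h2.isLink f hf'
  rw [swapMarked_run (by omega) (by omega) (by omega) (by rw [hr₃ 1 (by norm_num) (by norm_num)]; exact hf'),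
    hr₃ _ (by omega) (by omega), hr₃ _ (by omega) (by omega), ha₃ (4 + d) (by omega), ha₃ 0 (by norm_num),
    ha₃ 1 (by norm_num), Graph.kempe]
  classical
  refine if_congr ((or_congr (hmark _ hl.left_mem) (hmark _ hl.right_mem)).trans ⟨?_, ?_⟩) rfl rfl
  · rintro (h | h)
    exacts [⟨_, hl.inc_left, h⟩, ⟨_, hl.inc_right, h⟩]
  · rintro ⟨u, hu, h⟩
    rcases hu.eq_or_eq_of_isLink hl with rfl | rfl
    exacts [Or.inl h, Or.inr h]

/-- Set register `6` to `0` if the coloring in array `4` is not a partial proper coloring, and to `1`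
otherwise. -/
def checkProper : Cmd := seq (set 6 (.lit 1)) (loop 4 1 0 (seq
  (ite (.lt (.reg 2) (.get 4 (.reg 4))) (set 6 (.lit 0)) skip)
  (loop 5 1 0 (ite (.get 4 (.reg 4)) (ite (.eq (.get 4 (.reg 4)) (.get 4 (.reg 5)))
    (ite (.eq (.reg 4) (.reg 5)) skip (ite (.add
      (.add (.eq (.get 0 (.reg 4)) (.get 0 (.reg 5))) (.eq (.get 0 (.reg 4)) (.get 1 (.reg 5))))
      (.add (.eq (.get 1 (.reg 4)) (.get 0 (.reg 5))) (.eq (.get 1 (.reg 4)) (.get 1 (.reg 5)))))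
      (set 6 (.lit 0)) skip)) skip) skip))))

theorem checkProper_run (h : Holds G t s) :
    (checkProper.run s).reg 6 ≠ 0 ↔ G.IsPartialColoring t (s.arr 4) := by
  set ok : ℕ → ℕ → Prop := fun e f => s.arr 4 e ≠ 0 → s.arr 4 e = s.arr 4 f → e ≠ f →
    ¬ ((s.arr 0 e = s.arr 0 f ∨ s.arr 0 e = s.arr 1 f) ∨
      (s.arr 1 e = s.arr 0 f ∨ s.arr 1 e = s.arr 1 f)) with hok
  have key : (checkProper.run s).reg 6 ≠ 0 ↔
      ∀ e < s.reg 1, s.arr 4 e ≤ s.reg 2 ∧ ∀ f < s.reg 1, ok e f := by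
    unfold checkProper
    rw [run_seq, run_set]
    set s₁ := s.setReg 6 ((Expr.lit 1).eval s) with hs₁
    have hr₁ : ∀ r, r ≠ 6 → s₁.reg r = s.reg r := fun r hr => s.setReg_reg_of_ne hr
    rw [← hr₁ 1 (by norm_num), ← hr₁ 2 (by norm_num)]
    have h6 : s₁.reg 6 ≠ 0 := by simp [hs₁]
    have ha₁ : s₁.arr = s.arr := rfl
    rw [← ha₁] at hok
    rw [← ha₁]
    clear_value s₁
    refine run_loop (fun k s' => s'.reg 6 ≠ 0 ↔ ∀ e < k, s₁.arr 4 e ≤ s₁.reg 2 ∧ ∀ f < s₁.reg 1, ok e f)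
      ?_ ?_
    · simpa [Store.setReg_reg_of_ne] using h6
    · rintro k hk s' f1 f2 f3 ih
      rw [Store.setReg_reg_of_ne _ (by norm_num), run_seq]
      set s₂ := (ite (.lt (.reg 2) (.get 4 (.reg 4))) (set 6 (.lit 0)) skip).run s' with hs₂
      have g1 : ∀ r, r ≠ 4 → r ≠ 5 → r ≠ 6 → s₂.reg r = s₁.reg r := fun r h h' h'' => by
        rw [hs₂, run_reg (by simpa using h''), f1 r (by simp [*])]
      have g4 : s₂.reg 4 = k := by rw [hs₂, run_reg (by simp), f3]
      have g2 : s₂.arr = s₁.arr := by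
        funext a
        rw [hs₂, run_arr (by simp), f2 a (by simp)]
      have g6 : s₂.reg 6 ≠ 0 ↔ (∀ e < k, s₁.arr 4 e ≤ s₁.reg 2 ∧ ∀ f < s₁.reg 1, ok e f) ∧
          s₁.arr 4 k ≤ s₁.reg 2 := by
        rw [← ih, hs₂]
        simp only [run_ite, run_set, run_skip, Expr.eval, ite_one_zero_ne_zero, f3, f1 2 (by simp),
          f2 4 (by simp)]
        split_ifs with hlt
        · simp [hlt]
        · simp [not_lt.1 hlt]
      have inner := run_loop (i := 5) (b := 1) (k := 0)
        (p := ite (.get 4 (.reg 4)) (ite (.eq (.get 4 (.reg 4)) (.get 4 (.reg 5)))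
          (ite (.eq (.reg 4) (.reg 5)) skip (ite (.add
            (.add (.eq (.get 0 (.reg 4)) (.get 0 (.reg 5))) (.eq (.get 0 (.reg 4)) (.get 1 (.reg 5))))
            (.add (.eq (.get 1 (.reg 4)) (.get 0 (.reg 5))) (.eq (.get 1 (.reg 4)) (.get 1 (.reg 5)))))
            (set 6 (.lit 0)) skip)) skip) skip) (s := s₂)
        (fun l s'' => s''.reg 6 ≠ 0 ↔ s₂.reg 6 ≠ 0 ∧ ∀ f < l, ok k f)
        (by simp [Store.setReg_reg_of_ne]) ?_
      · rw [inner, g6, g1 1 (by norm_num) (by norm_num) (by norm_num), and_assoc]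
        constructor
        · rintro ⟨h1, h2, h3⟩ e he
          rcases (Nat.lt_succ_iff.1 he).lt_or_eq with he | rfl
          exacts [h1 e he, ⟨h2, h3⟩]
        · exact fun h => ⟨fun e he => h e (by omega), h k (by omega)⟩
      · rintro l hl s'' e1 e2 e3 ih'
        have e4 : s''.reg 4 = k := by rw [e1 4 (by simp), g4]
        have e5 : ∀ a, s''.arr a = s₁.arr a := fun a => by rw [e2 a (by simp), g2]
        have hsplit : (∀ f < l + 1, ok k f) ↔ (∀ f < l, ok k f) ∧ ok k l := by
          simp only [Nat.lt_succ_iff_lt_or_eq, or_imp, forall_and, forall_eq]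
        have hadd : ∀ p q : ℕ, p + q ≠ 0 ↔ p ≠ 0 ∨ q ≠ 0 := fun p q => by omega
        rw [Store.setReg_reg_of_ne _ (by norm_num), hsplit, ← and_assoc, ← ih']
        simp only [run_ite, run_set, run_skip, Expr.eval, hadd, ite_one_zero_ne_zero, e3, e4, e5]
        simp only [hok]
        split_ifs <;> simp_all
  rw [key]
  have hsh : ∀ e f, e < s.reg 1 → f < s.reg 1 → (((s.arr 0 e = s.arr 0 f ∨ s.arr 0 e = s.arr 1 f) ∨
      (s.arr 1 e = s.arr 0 f ∨ s.arr 1 e = s.arr 1 f)) ↔ ∃ x, G.Inc e x ∧ G.Inc f x) := by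
    intro e f he hf
    simp only [h.inc_iff he, h.inc_iff hf]
    constructor
    · rintro ((h | h) | (h | h))
      exacts [⟨_, Or.inl h, Or.inl rfl⟩, ⟨_, Or.inl h, Or.inr rfl⟩, ⟨_, Or.inr h, Or.inl rfl⟩,
        ⟨_, Or.inr h, Or.inr rfl⟩]
    · rintro ⟨x, rfl | rfl, h | h⟩ <;> simp [h]
  constructor
  · refine fun hall => ⟨fun e he => h.reg_two ▸ (hall e (h.mem_edgeSet.1 he)).1, fun e f x he hf hef h0 => ?_⟩
    have he' := h.mem_edgeSet.1 he.edge_mem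
    have hf' := h.mem_edgeSet.1 hf.edge_mem
    by_contra hne
    exact (hall e he').2 f hf' h0 hef hne ((hsh e f he' hf').2 ⟨x, he, hf⟩)
  · refine fun hc e he => ⟨h.reg_two ▸ hc.le e (h.mem_edgeSet.2 he), fun f hf h0 hef hne hs => ?_⟩
    obtain ⟨x, hex, hfx⟩ := (hsh e f he hf).1 hs
    exact hne (hc.eq e f x hex hfx hef h0)

/-- Run all sequences of `d` recoloring steps on the coloring in array `4 + d`. Proper colorings with
more colored edges than the content of register `3` are stored in array `2`. -/
def search : ℕ → Cmd
  | 0 => seq checkProper (seq (count 4 7)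
      (ite (.reg 6) (ite (.lt (.reg 3) (.reg 7)) (copy 4 2) skip) skip))
  -- The constant `1` in the loops over register `2` lets colors range over `0, …, t`, including the
  -- uncolored value.
  | d + 1 => loop (20 + 5 * d) 1 0 (loop (21 + 5 * d) 2 1 (loop (22 + 5 * d) 0 0
      (loop (23 + 5 * d) 2 1 (loop (24 + 5 * d) 2 1 (seq (recolor d) (search d))))))

theorem search_writesReg {d r : ℕ} (h : (search d).WritesReg r) : 4 ≤ r ∧ r < 20 + 5 * d := by
  induction d with
  | zero => simp [search, checkProper, count, copy] at h; omega
  | succ d ih =>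
    simp only [search, WritesReg] at h
    rcases h with h | h | h | h | h | h | h
    any_goals omega
    · have := recolor_writesReg h; omega
    · have := ih h; omega

theorem search_writesArr {d a : ℕ} (h : (search d).WritesArr a) : 2 ≤ a ∧ a < 4 + d := by
  induction d with
  | zero => simp [search, checkProper, count, copy] at h; omega
  | succ d ih =>
    simp only [search, WritesArr] at h
    rcases h with h | h
    · have := recolor_writesArr h; omega
    · have := ih h; omega

theorem search_wf (d : ℕ) : (search d).Wf := by
  induction d with
  | zero => simp [search, checkProper, count, copy]
  | succ d ih =>
    have h1 : ∀ r, 20 + 5 * d ≤ r → ¬ (recolor d).WritesReg r := fun r hr h => by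
      have := recolor_writesReg h; omega
    have h2 : ∀ r, 20 + 5 * d ≤ r → ¬ (search d).WritesReg r := fun r hr h => by
      have := search_writesReg h; omega
    simp [search, recolor_wf, ih, h1, h2]
    omega

/-- The state during the search: register `3` holds `N`, array `2` holds a partial coloring with at
least `N` colored edges, and array `4 + d` holds the coloring `c`. -/
structure SearchState (G : Graph ℕ ℕ) (t N d : ℕ) (c : ℕ → ℕ) (s : Store) : Prop where
  holds : Holds G t s
  reg_three : s.reg 3 = N
  isPartialColoring : G.IsPartialColoring t (s.arr 2)
  le : N ≤ G.coloredCard (s.arr 2)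
  agree : ∀ e ∈ E(G), s.arr (4 + d) e = c e

theorem SearchState.setReg {d : ℕ} {c : ℕ → ℕ} (h : SearchState G t N d c s) {i x : ℕ} (hi : 4 ≤ i) :
    SearchState G t N d c (s.setReg i x) :=
  ⟨h.holds.setReg (by omega), by rw [s.setReg_reg_of_ne (by omega), h.reg_three], h.isPartialColoring,
    h.le, h.agree⟩

/-- The program preserves `P`, preserves the property that array `2` holds a coloring with more than
`N` colored edges, and establishes this property if `Q` is true. -/
def Finds (G : Graph ℕ ℕ) (N : ℕ) (p : Cmd) (P : Store → Prop) (Q : Prop) : Prop :=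
  ∀ s, P s → P (p.run s) ∧
    (N < G.coloredCard (s.arr 2) ∨ Q → N < G.coloredCard ((p.run s).arr 2))

/-- A success in any round survives the later ones, because every round preserves having more than
`N` colored edges. -/
theorem Finds.loop {i b k K : ℕ} {p : Cmd} {P : Store → Prop} {Q : ℕ → Prop}
    (hP : ∀ s x, P s → P (s.setReg i x)) (hb : ∀ s, P s → s.reg b + k = K)
    (h : ∀ j < K, Finds G N p (fun s => P s ∧ s.reg i = j) (Q j)) :
    Finds G N (.loop i b k p) P (∃ j < K, Q j) := by
  intro s hs
  rw [← hb s hs] at h ⊢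
  refine run_loop (fun j s' => P s' ∧
    (N < G.coloredCard (s.arr 2) ∨ (∃ j' < j, Q j') → N < G.coloredCard (s'.arr 2)))
    ⟨hP s 0 hs, ?_⟩ ?_
  · rintro (h | ⟨_, h, _⟩)
    exacts [h, absurd h (Nat.not_lt_zero _)]
  · rintro j hj s' - - hi ⟨h1, h2⟩
    obtain ⟨h3, h4⟩ := h j hj s' ⟨h1, hi⟩
    refine ⟨hP _ _ h3.1, ?_⟩
    rintro (h5 | ⟨j', hj', hQ⟩)
    · exact h4 (Or.inl (h2 (Or.inl h5)))
    · rcases (Nat.lt_succ_iff.1 hj').eq_or_lt with rfl | hj'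
      · exact h4 (Or.inr hQ)
      · exact h4 (Or.inl (h2 (Or.inr ⟨j', hj', hQ⟩)))

theorem search_zero_finds (c : ℕ → ℕ) :
    Finds G N (search 0) (SearchState G t N 0 c) (G.Improvable t N 0 c) := by
  intro s h
  have hck := checkProper_run h.holds
  simp only [search, run_seq]
  set s₁ := checkProper.run s with hs₁
  have hr₁ : ∀ r, r < 4 → s₁.reg r = s.reg r := fun r hr => run_reg (by simp [checkProper]; omega) s
  have ha₁ : ∀ a, s₁.arr a = s.arr a := fun a => run_arr (by simp [checkProper]) s
  have h1 : Holds G t s₁ := h.holds.of_eq (fun r hr => hr₁ r (by omega)) fun a _ => ha₁ a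
  have hct := count_run h1 (a := 4) (r := 7) (by omega)
  have hr₂ : ∀ r, r < 4 → ((count 4 7).run s₁).reg r = s.reg r := fun r hr => by
    rw [run_reg (by simp [count]; omega), hr₁ r hr]
  have hr₆ : ((count 4 7).run s₁).reg 6 = s₁.reg 6 := run_reg (by simp [count]) s₁
  have ha₂ : ∀ a, ((count 4 7).run s₁).arr a = s.arr a := fun a => by
    rw [run_arr (by simp [count]), ha₁]
  set s₂ := (count 4 7).run s₁
  have h2 : Holds G t s₂ := h.holds.of_eq (fun r hr => hr₂ r (by omega)) fun a _ => ha₂ a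
  have hS : SearchState G t N 0 c s₂ := ⟨h2, by rw [hr₂ 3 (by norm_num), h.reg_three],
    by rw [ha₂]; exact h.isPartialColoring, by rw [ha₂]; exact h.le, by rw [ha₂]; exact h.agree⟩
  have hno : ∀ Q : Prop, ¬ Q → N < G.coloredCard (s.arr 2) ∨ Q → N < G.coloredCard (s₂.arr 2) := by
    rintro Q hQ (h | h)
    exacts [by rwa [ha₂], absurd h hQ]
  rw [ha₁] at hct
  simp only [run_ite, run_skip, Expr.eval, hr₆, hct, hS.reg_three,
    ite_one_zero_ne_zero]
  have hcc : G.coloredCard (s.arr 4) = G.coloredCard c := Graph.coloredCard_congr h.agree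
  split_ifs with hp hlt
  · rw [hcc] at hlt
    have hcp : ∀ e ∈ E(G), ((copy 4 2).run s₂).arr 2 e = s.arr 4 e := fun e he => by
      rw [copy_run (by norm_num) _ (h2.mem_edgeSet.1 he), ha₂]
    have hcc' := (Graph.coloredCard_congr hcp).trans hcc
    refine ⟨⟨h2.run (by simp [copy]) (by simp [copy]) (by simp [copy]), ?_, (hck.1 hp).congr hcp, ?_, ?_⟩,
      fun _ => ?_⟩
    · rw [run_reg (by simp [copy]), hS.reg_three]
    · omega
    · rw [run_arr (by simp [copy])]; exact hS.agree
    · omega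
  · exact ⟨hS, hno _ fun hI => by rw [hcc] at *; have := hI.2; omega⟩
  · exact ⟨hS, hno _ fun hI => hp (hck.2 (hI.1.congr h.agree))⟩

theorem search_finds (d : ℕ) (c : ℕ → ℕ) :
    Finds G N (search d) (SearchState G t N d c) (G.Improvable t N d c) := by
  induction d generalizing c with
  | zero => exact search_zero_finds c
  | succ d ih =>
    intro s hs
    -- Registers `0` and `1` are frozen in the invariant, so that the loop bounds are fixed numbers;
    -- register `2` is already fixed by `SearchState`.
    have key : Finds G N (search (d + 1)) (fun s' => SearchState G t N (d + 1) c s' ∧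
        s'.reg 0 = s.reg 0 ∧ s'.reg 1 = s.reg 1)
        (∃ e < s.reg 1, ∃ k < t + 1, ∃ v < s.reg 0, ∃ i < t + 1, ∃ j < t + 1,
          G.Improvable t N d (G.kempe (Function.update c e k) v i j)) := by
      refine .loop (fun s' x h => ⟨h.1.setReg (by omega), by
        simpa only [s'.setReg_reg_of_ne (show 0 ≠ 20 + 5 * d by omega),
          s'.setReg_reg_of_ne (show 1 ≠ 20 + 5 * d by omega)] using h.2⟩) (fun s' h => h.2.2) fun e he => ?_
      refine .loop (fun s' x h => ⟨⟨h.1.1.setReg (by omega), by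
        simpa only [s'.setReg_reg_of_ne (show 0 ≠ 21 + 5 * d by omega),
          s'.setReg_reg_of_ne (show 1 ≠ 21 + 5 * d by omega)] using h.1.2⟩, by
        rw [s'.setReg_reg_of_ne (by omega), h.2]⟩) (fun s' h => by rw [h.1.1.holds.reg_two])
        fun k hk => ?_
      refine .loop (fun s' x h => ⟨⟨⟨h.1.1.1.setReg (by omega), by
        simpa only [s'.setReg_reg_of_ne (show 0 ≠ 22 + 5 * d by omega),
          s'.setReg_reg_of_ne (show 1 ≠ 22 + 5 * d by omega)] using h.1.1.2⟩, by
        rw [s'.setReg_reg_of_ne (by omega), h.1.2]⟩, by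
        rw [s'.setReg_reg_of_ne (by omega), h.2]⟩) (fun s' h => h.1.1.2.1) fun v hv => ?_
      refine .loop (fun s' x h => ⟨⟨⟨⟨h.1.1.1.1.setReg (by omega), by
        simpa only [s'.setReg_reg_of_ne (show 0 ≠ 23 + 5 * d by omega),
          s'.setReg_reg_of_ne (show 1 ≠ 23 + 5 * d by omega)] using h.1.1.1.2⟩, by
        rw [s'.setReg_reg_of_ne (by omega), h.1.1.2]⟩, by
        rw [s'.setReg_reg_of_ne (by omega), h.1.2]⟩, by
        rw [s'.setReg_reg_of_ne (by omega), h.2]⟩) (fun s' h => by rw [h.1.1.1.1.holds.reg_two])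
        fun i hi => ?_
      refine .loop (fun s' x h => ⟨⟨⟨⟨⟨h.1.1.1.1.1.setReg (by omega), by
        simpa only [s'.setReg_reg_of_ne (show 0 ≠ 24 + 5 * d by omega),
          s'.setReg_reg_of_ne (show 1 ≠ 24 + 5 * d by omega)] using h.1.1.1.1.2⟩, by
        rw [s'.setReg_reg_of_ne (by omega), h.1.1.1.2]⟩, by
        rw [s'.setReg_reg_of_ne (by omega), h.1.1.2]⟩, by
        rw [s'.setReg_reg_of_ne (by omega), h.1.2]⟩, by
        rw [s'.setReg_reg_of_ne (by omega), h.2]⟩) (fun s' h => by rw [h.1.1.1.1.1.holds.reg_two])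
        fun j hj => ?_
      rintro s' ⟨⟨⟨⟨⟨⟨hS, h0, h1⟩, hre⟩, hrk⟩, hrv⟩, hri⟩, hrj⟩
      have hreg : ∀ r, r < 4 ∨ 20 + 5 * d ≤ r → ((recolor d).run s').reg r = s'.reg r := fun r hr =>
        run_reg (fun h => by have := recolor_writesReg h; omega) s'
      have harr : ∀ a, a ≠ 3 → a ≠ 4 + d → ((recolor d).run s').arr a = s'.arr a := fun a ha ha' =>
        run_arr (fun h => by have := recolor_writesArr h; omega) s'
      have hrun : SearchState G t N d (G.kempe (Function.update c e k) v i j) ((recolor d).run s') := by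
        refine ⟨hS.holds.of_eq (fun r hr => hreg r (by omega)) fun a ha => harr a (by omega) (by omega),
          by rw [hreg 3 (by omega), hS.reg_three], by
            rw [harr 2 (by omega) (by omega)]; exact hS.isPartialColoring, by
            rw [harr 2 (by omega) (by omega)]; exact hS.le, fun f hf => ?_⟩
        rw [recolor_run hS.holds (by rw [hrv, hS.holds.mem_vertexSet, h0]; exact hv) hf, hre, hrk, hrv,
          hri, hrj]
        refine Graph.kempe_congr (fun f hf => ?_) f hf
        simp only [Function.update_apply, ← hS.agree f hf, show 4 + (d + 1) = 5 + d by omega]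
      obtain ⟨h3, h4⟩ := ih _ _ hrun
      have hreg' : ∀ r, r < 4 ∨ 20 + 5 * d ≤ r →
          ((seq (recolor d) (search d)).run s').reg r = s'.reg r := fun r hr => by
        rw [run_seq, run_reg (fun h => by have := search_writesReg h; omega), hreg r hr]
      rw [harr 2 (by omega) (by omega)] at h4
      refine ⟨⟨⟨⟨⟨⟨⟨⟨h3.holds, h3.reg_three, h3.isPartialColoring, h3.le, fun f hf => ?_⟩, ?_⟩, ?_⟩, ?_⟩,
        ?_⟩, ?_⟩, ?_⟩, h4⟩
      · rw [run_seq, run_arr (fun h => by have := search_writesArr h; omega),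
          harr _ (by omega) (by omega), hS.agree f hf]
      · rw [hreg' 0 (by omega), hreg' 1 (by omega)]; exact ⟨h0, h1⟩
      all_goals rw [hreg' _ (by omega)]; assumption
    obtain ⟨h1, h2⟩ := key s ⟨hs, rfl, rfl⟩
    refine ⟨h1.1, fun h => h2 (h.imp_right ?_)⟩
    rintro ⟨_, ⟨e, he, k, hk, v, hv, i, hi, j, hj, rfl⟩, hI⟩
    exact ⟨e, hs.holds.mem_edgeSet.1 he, k, by omega, v, hs.holds.mem_vertexSet.1 hv, i, by omega, j,
      by omega, hI⟩

/-! ## The algorithm -/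

/-- Color all edges, by repeated search for an improvement of the coloring in array `2`. -/
def colorAll : Cmd := loop 60 1 0 (seq (copy 2 12) (seq (count 2 3) (search 8)))

theorem colorAll_body_writesReg {r : ℕ}
    (h : (seq (copy 2 12) (seq (count 2 3) (search 8))).WritesReg r) : 3 ≤ r ∧ r < 60 := by
  simp only [WritesReg] at h
  rcases h with h | h | h
  · simp [copy] at h; omega
  · simp [count] at h; omega
  · have := search_writesReg h; omega

theorem colorAll_body_writesArr {a : ℕ}
    (h : (seq (copy 2 12) (seq (count 2 3) (search 8))).WritesArr a) : 2 ≤ a := by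
  simp only [WritesArr] at h
  rcases h with h | h | h
  · simp [copy] at h; omega
  · simp [count] at h
  · exact (search_writesArr h).1

/-- The search writes only to registers below `20 + 5 * 8 = 60`, which leaves register `60` for the
outer counter. -/
theorem colorAll_wf : colorAll.Wf := by
  refine ⟨by norm_num, by norm_num, fun h => ?_, ?_⟩
  · have := colorAll_body_writesReg h; omega
  · exact ⟨by simp [copy], by simp [count], search_wf 8⟩

/-- Each round colors at least one more edge unless all are colored, so one round per edge is
enough. -/
theorem colorAll_run (h : Holds G t s) {Δ : ℕ} (hG : G.IsSparse t Δ)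
    (hc : G.IsPartialColoring t (s.arr 2)) :
    G.IsPartialColoring t ((colorAll.run s).arr 2) ∧
      E(G).ncard ≤ G.coloredCard ((colorAll.run s).arr 2) := by
  rw [h.ncard_edgeSet]
  refine run_loop (fun j s' => G.IsPartialColoring t (s'.arr 2) ∧ j ≤ G.coloredCard (s'.arr 2))
    ⟨hc, Nat.zero_le _⟩ ?_
  rintro j hj s' f1 f2 - ⟨i1, i2⟩
  have h' : Holds G t s' := h.of_eq
    (fun r hr => f1 r fun hw => by
      rcases hw with rfl | hw
      · omega
      · have := colorAll_body_writesReg hw; omega)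
    (fun a ha => f2 a fun hw => by have := colorAll_body_writesArr hw; omega)
  rw [Store.setReg_arr]
  simp only [run_seq]
  set s₁ := (copy 2 12).run s' with hs₁
  have h1 : Holds G t s₁ := h'.run (by simp [copy]) (by simp [copy]) (by simp [copy])
  have e1 : s₁.arr 2 = s'.arr 2 := run_arr (by simp [copy]) s'
  have e2 : ∀ e ∈ E(G), s₁.arr 12 e = s'.arr 2 e := fun e he =>
    copy_run (by norm_num) s' (h'.mem_edgeSet.1 he)
  have h2 : Holds G t ((count 2 3).run s₁) := h1.run (by simp [count]) (by simp [count]) (by simp [count])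
  have e3 : ∀ a, ((count 2 3).run s₁).arr a = s₁.arr a := fun a => run_arr (by simp [count]) s₁
  have e4 := count_run h1 (a := 2) (r := 3) (Or.inr rfl)
  rw [e1] at e4
  -- A search of depth `8` starts from array `12 = 4 + 8`; register `3` holds the number of colored
  -- edges to be exceeded.
  have hS : SearchState G t (G.coloredCard (s'.arr 2)) 8 (s'.arr 2) ((count 2 3).run s₁) :=
    ⟨h2, e4, by rw [e3, e1]; exact i1, by rw [e3, e1], fun e he => by rw [e3, ← e2 e he]⟩
  obtain ⟨h3, h4⟩ := search_finds 8 _ _ hS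
  refine ⟨h3.isPartialColoring, ?_⟩
  have h5 := h3.le
  by_cases hlt : G.coloredCard (s'.arr 2) < E(G).ncard
  · obtain ⟨e, he, h0⟩ := Graph.exists_eq_zero_of_coloredCard_lt hlt
    have := h4 (Or.inr (i1.improvable hG he h0))
    omega
  · rw [h.ncard_edgeSet] at hlt
    omega

/-- Compute the maximum degree in register `9`. -/
def maxDegree : Cmd := seq (set 9 (.lit 0)) (loop 10 0 0 (seq (set 11 (.lit 0)) (seq
  (loop 4 1 0 (ite (.add (.eq (.get 0 (.reg 4)) (.reg 10)) (.eq (.get 1 (.reg 4)) (.reg 10)))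
    (set 11 (.add (.reg 11) (.lit 1))) skip))
  (ite (.lt (.reg 9) (.reg 11)) (set 9 (.reg 11)) skip))))

theorem degreeLoop_run (h : Holds G t s) (h0 : s.reg 11 = 0) :
    ((loop 4 1 0 (ite (.add (.eq (.get 0 (.reg 4)) (.reg 10)) (.eq (.get 1 (.reg 4)) (.reg 10)))
      (set 11 (.add (.reg 11) (.lit 1))) skip)).run s).reg 11 = (G.incidenceSet (s.reg 10)).ncard := by
  rw [run_loop_count (fun e => s.arr 0 e = s.reg 10 ∨ s.arr 1 e = s.reg 10) (by norm_num) h0,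
    ← h.ncard_sep]
  · congr 1
    ext e
    constructor
    · exact fun ⟨he, h'⟩ => (h.inc_iff (h.mem_edgeSet.1 he)).2 h'
    · exact fun he => ⟨he.edge_mem, (h.inc_iff (h.mem_edgeSet.1 he.edge_mem)).1 he⟩
  · intro j hj s' f1 f2 f3
    simp only [run_ite, run_set, run_skip, Expr.eval, f3, f2 0 (by simp), f2 1 (by simp),
      f1 10 (by simp), ite_add_ite_ne_zero]
    split_ifs <;> simp

theorem maxDegree_run (h : Holds G t s) {t' : ℤ} (hG : IsInstance G t') :
    (maxDegree.run s).reg 9 = G.maxDegree := by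
  have key : (∀ x < s.reg 0, G.degree x ≤ (maxDegree.run s).reg 9) ∧
      (maxDegree.run s).reg 9 ≤ G.maxDegree := by
    unfold maxDegree
    rw [run_seq]
    set s₀ := (set 9 (.lit 0)).run s with hs₀
    have h₀ : Holds G t s₀ := h.setReg (by norm_num)
    have h9 : s₀.reg 9 = 0 := s.setReg_reg_self ..
    have hn : s.reg 0 = s₀.reg 0 + 0 := (run_reg (p := set 9 (.lit 0)) (r := 0) (by simp) s).symm
    rw [hn]
    refine run_loop (fun j s' => (∀ x < j, G.degree x ≤ s'.reg 9) ∧ s'.reg 9 ≤ G.maxDegree)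
      ⟨fun x hx => absurd hx (Nat.not_lt_zero x), ?_⟩ ?_
    · rw [Store.setReg_reg_of_ne _ (show 9 ≠ 10 by norm_num), h9]
      exact Nat.zero_le _
    · rintro j hj s' f1 f2 f3 ⟨i1, i2⟩
      have h' : Holds G t s' := h₀.of_eq (fun r hr => f1 r (by simp; omega)) fun a ha => f2 a (by simp)
      have hd := degreeLoop_run (h'.setReg (i := 11) (x := 0) (by norm_num)) (by simp)
      have hjV : j ∈ V(G) := h₀.mem_vertexSet.2 hj
      have hjd : (G.incidenceSet j).ncard ≤ G.maxDegree := hG.ncard_incidenceSet_le hjV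
      rw [Store.setReg_reg_of_ne _ (show 10 ≠ 11 by norm_num), f3, ← hG.degree_eq] at hd
      rw [← hG.degree_eq] at hjd
      simp only [run_seq, run_set, run_ite, run_skip, Expr.eval, hd, ite_one_zero_ne_zero,
        Store.setReg_reg_of_ne _ (show 9 ≠ 10 by norm_num)]
      have hr9 := run_reg (p := loop 4 1 0 (ite (.add (.eq (.get 0 (.reg 4)) (.reg 10))
        (.eq (.get 1 (.reg 4)) (.reg 10))) (set 11 (.add (.reg 11) (.lit 1))) skip)) (r := 9) (by simp)
        (s'.setReg 11 0)
      rw [Store.setReg_reg_of_ne _ (by norm_num)] at hr9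
      simp only [hr9]
      split_ifs with hlt
      · rw [Store.setReg_reg_self]
        refine ⟨fun x hx => ?_, hjd⟩
        rcases (Nat.lt_succ_iff.1 hx).lt_or_eq with hx | rfl
        · exact (i1 x hx).trans hlt.le
        · exact le_rfl
      · rw [hr9]
        refine ⟨fun x hx => ?_, i2⟩
        rcases (Nat.lt_succ_iff.1 hx).lt_or_eq with hx | rfl
        · exact i1 x hx
        · exact not_lt.1 hlt
  refine key.2.antisymm ?_
  unfold Graph.maxDegree
  rcases isEmpty_or_nonempty V(G) with hV | hV
  · simp
  · exact ciSup_le fun x => key.1 x (h.mem_vertexSet.1 x.2)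

/-- Find, in register `14`, the smallest color class among the colors up to the content of register
`12`. -/
def smallestClass : Cmd := seq (set 14 (.lit 1)) (seq (set 15 (.reg 1)) (loop 10 2 0
  (ite (.lt (.reg 10) (.reg 12)) (seq (set 11 (.lit 0)) (seq
    (loop 4 1 0 (ite (.eq (.get 2 (.reg 4)) (.add (.reg 10) (.lit 1)))
      (set 11 (.add (.reg 11) (.lit 1))) skip))
    (ite (.lt (.reg 11) (.reg 15)) (seq (set 15 (.reg 11)) (set 14 (.add (.reg 10) (.lit 1)))) skip)))
    skip)))

theorem classLoop_run (h : Holds G t s) (h0 : s.reg 11 = 0) :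
    ((loop 4 1 0 (ite (.eq (.get 2 (.reg 4)) (.add (.reg 10) (.lit 1)))
      (set 11 (.add (.reg 11) (.lit 1))) skip)).run s).reg 11 =
      G.classCard (s.arr 2) (s.reg 10 + 1) := by
  rw [run_loop_count (fun e => s.arr 2 e = s.reg 10 + 1) (by norm_num) h0, ← h.ncard_sep]
  · rfl
  · intro j hj s' f1 f2 f3
    simp only [run_ite, run_set, run_skip, Expr.eval, f3, f2 2 (by simp), f1 10 (by simp),
      ite_one_zero_ne_zero]
    split_ifs <;> simp

theorem smallestClass_run (h : Holds G t s) (h1 : 1 ≤ s.reg 12) (h2 : s.reg 12 ≤ t) :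
    1 ≤ (smallestClass.run s).reg 14 ∧ (smallestClass.run s).reg 14 ≤ s.reg 12 ∧
    ∀ j, j ≠ 0 → j ≤ s.reg 12 →
      G.classCard (s.arr 2) ((smallestClass.run s).reg 14) ≤ G.classCard (s.arr 2) j := by
  unfold smallestClass
  simp only [run_seq, run_set, Expr.eval]
  set s₀ := (s.setReg 14 1).setReg 15 ((s.setReg 14 1).reg 1) with hs₀
  have hr : ∀ r, r ≠ 14 → r ≠ 15 → s₀.reg r = s.reg r := fun r h h' => by
    rw [hs₀, Store.setReg_reg_of_ne _ h', Store.setReg_reg_of_ne _ h]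
  have h₀ : Holds G t s₀ := (h.setReg (by norm_num)).setReg (by norm_num)
  have h14 : s₀.reg 14 = 1 := by simp [hs₀, Store.setReg_reg]
  have h15 : s₀.reg 15 = s₀.reg 1 := by simp [hs₀, Store.setReg_reg]
  rw [← hr 12 (by norm_num) (by norm_num)] at *
  rw [show s.arr 2 = s₀.arr 2 from rfl]
  clear_value s₀
  have key := run_loop (i := 10) (b := 2) (k := 0) (s := s₀) (p := (ite (.lt (.reg 10) (.reg 12))
    (seq (set 11 (.lit 0)) (seq
    (loop 4 1 0 (ite (.eq (.get 2 (.reg 4)) (.add (.reg 10) (.lit 1)))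
      (set 11 (.add (.reg 11) (.lit 1))) skip))
    (ite (.lt (.reg 11) (.reg 15)) (seq (set 15 (.reg 11)) (set 14 (.add (.reg 10) (.lit 1)))) skip)))
    skip)) (fun j s' => (1 ≤ s'.reg 14 ∧ s'.reg 14 ≤ s₀.reg 12) ∧
      G.classCard (s₀.arr 2) (s'.reg 14) ≤ s'.reg 15 ∧
      ∀ j' < j, j' < s₀.reg 12 → s'.reg 15 ≤ G.classCard (s₀.arr 2) (j' + 1)) ?_ ?_
  · obtain ⟨⟨k1, k2⟩, k3, k4⟩ := key
    refine ⟨k1, k2, fun j hj hj' => k3.trans ?_⟩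
    obtain ⟨j, rfl⟩ := Nat.exists_eq_succ_of_ne_zero hj
    exact k4 j (by rw [h₀.reg_two]; omega) (by omega)
  · simp only [Store.setReg_reg_of_ne _ (show 14 ≠ 10 by norm_num),
      Store.setReg_reg_of_ne _ (show 15 ≠ 10 by norm_num), h14, h15]
    -- The initial candidate is color `1`, with the number of edges as a crude bound for its class;
    -- the invariant needs an upper bound only.
    refine ⟨⟨le_rfl, h1⟩, ?_, fun j hj => absurd hj (Nat.not_lt_zero j)⟩
    rw [← h₀.ncard_edgeSet]
    refine Set.ncard_le_ncard (fun _ h => h.1) ?_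
    rw [h₀.edgeSet]
    exact Set.finite_lt_nat _
  · rintro j hj s' f1 f2 f3 ⟨⟨i1, i2⟩, i3, i4⟩
    have h' : Holds G t s' := h₀.of_eq (fun r hr => f1 r (by simp; omega)) fun a ha => f2 a (by simp)
    have hd := classLoop_run (h'.setReg (i := 11) (x := 0) (by norm_num)) (by simp)
    rw [Store.setReg_reg_of_ne _ (show 10 ≠ 11 by norm_num), f3, Store.setReg_arr, f2 2 (by simp)] at hd
    simp only [Store.setReg_reg_of_ne _ (show 14 ≠ 10 by norm_num),
      Store.setReg_reg_of_ne _ (show 15 ≠ 10 by norm_num)]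
    rw [run_ite]
    simp only [Expr.eval, f3, f1 12 (by simp), ite_one_zero_ne_zero]
    split_ifs with hjk
    · simp only [run_seq, run_set, run_ite, Expr.eval]
      have hrr : ∀ r, r ≠ 4 → r ≠ 11 → ((loop 4 1 0 (ite (.eq (.get 2 (.reg 4)) (.add (.reg 10) (.lit 1)))
        (set 11 (.add (.reg 11) (.lit 1))) skip)).run (s'.setReg 11 0)).reg r = s'.reg r :=
        fun r hr hr' => by
          rw [run_reg (by simp [hr, hr']), Store.setReg_reg_of_ne _ hr']
      simp only [hd, hrr 15 (by norm_num) (by norm_num), ite_one_zero_ne_zero]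
      have hlast : ∀ j' < j + 1, j' < j ∨ j' = j := fun j' hj' => by omega
      split_ifs with hlt
      · simp only [Store.setReg_reg_self, Store.setReg_reg_of_ne _ (show 10 ≠ 15 by norm_num),
          Store.setReg_reg_of_ne _ (show 15 ≠ 14 by norm_num), hrr 10 (by norm_num) (by norm_num), f3]
        refine ⟨⟨by omega, by omega⟩, le_rfl, fun j' hj' hj'' => ?_⟩
        rcases hlast j' hj' with hj' | rfl
        · exact hlt.le.trans (i4 j' hj' hj'')
        · exact le_rfl
      · simp only [run_skip, hrr 14 (by norm_num) (by norm_num), hrr 15 (by norm_num) (by norm_num)]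
        refine ⟨⟨i1, i2⟩, i3, fun j' hj' hj'' => ?_⟩
        rcases hlast j' hj' with hj' | rfl
        · exact i4 j' hj' hj''
        · exact not_lt.1 hlt
    · exact ⟨⟨i1, i2⟩, i3, fun j' hj' hj'' => i4 j' (by omega) hj''⟩

/-- Uncolor the class of the color in register `14`, and give this color to the edges in the color in
register `12`. -/
def dropColor : Cmd := loop 4 1 0 (ite (.eq (.get 2 (.reg 4)) (.reg 14)) (put 2 (.reg 4) (.lit 0))
  (ite (.eq (.get 2 (.reg 4)) (.reg 12)) (put 2 (.reg 4) (.reg 14)) skip))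

theorem dropColor_run {e : ℕ} (he : e < s.reg 1) :
    (dropColor.run s).arr 2 e = Graph.dropColor (s.arr 2) (s.reg 12) (s.reg 14) e := by
  unfold dropColor
  rw [run_loop_map fun _ k => if k = s.reg 14 then 0 else if k = s.reg 12 then s.reg 14 else k]
  · simp [he, Graph.dropColor]
  · intro j hj s' f1 f2 f3
    simp only [run_ite, run_put, run_skip, Expr.eval, f3, f1 12 (by simp), f1 14 (by simp),
      ite_one_zero_ne_zero]
    split_ifs <;> simp

/-- Remove smallest color classes until the number of colors is the content of register `9`. -/
def reduceColors : Cmd := seq (set 12 (.reg 2)) (loop 13 2 0 (ite (.lt (.reg 9) (.reg 12))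
  (seq smallestClass (seq dropColor (set 12 (.sub (.reg 12) (.lit 1))))) skip))

theorem reduceColors_run (h : Holds G t s) (hE : E(G).Finite) (ht : s.reg 9 ≤ t)
    (hc : G.IsPartialColoring t (s.arr 2)) (hall : E(G).ncard ≤ G.coloredCard (s.arr 2)) :
    G.IsPartialColoring (s.reg 9) ((reduceColors.run s).arr 2) ∧
      s.reg 9 * E(G).ncard ≤ t * G.coloredCard ((reduceColors.run s).arr 2) := by
  unfold reduceColors
  rw [run_seq, run_set, Expr.eval, h.reg_two]
  rw [show s.arr 2 = (s.setReg 12 t).arr 2 from rfl] at hc hall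
  rw [show s.reg 9 = (s.setReg 12 t).reg 9 from (s.setReg_reg_of_ne (by norm_num)).symm] at *
  have h12 : (s.setReg 12 t).reg 12 = t := s.setReg_reg_self ..
  replace h : Holds G t (s.setReg 12 t) := h.setReg (by norm_num)
  generalize s.setReg 12 t = s₀ at *
  -- Loop bounds must be input registers, so `t` rounds are run. After `j` rounds either `j` colors
  -- are gone or the target number has been reached, and the remaining rounds are idle.
  have key := run_loop (i := 13) (b := 2) (k := 0) (s := s₀) (p := (ite (.lt (.reg 9) (.reg 12))
    (seq smallestClass (seq dropColor (set 12 (.sub (.reg 12) (.lit 1))))) skip))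
    (fun j s' => (s₀.reg 9 ≤ s'.reg 12 ∧ s'.reg 12 ≤ t ∧ (s'.reg 12 + j ≤ t ∨ s'.reg 12 = s₀.reg 9)) ∧
      G.IsPartialColoring (s'.reg 12) (s'.arr 2) ∧
      s'.reg 12 * E(G).ncard ≤ t * G.coloredCard (s'.arr 2)) ?_ ?_
  · obtain ⟨⟨k1, k2, k3⟩, k4⟩ := key
    rw [h.reg_two] at k3
    have heq : Store.reg _ 12 = s₀.reg 9 := k3.elim (fun h => by omega) id
    rwa [heq] at k4
  · simp only [Store.setReg_reg_of_ne _ (show 12 ≠ 13 by norm_num), h12, Store.setReg_arr]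
    exact ⟨⟨ht, le_rfl, Or.inl le_rfl⟩, hc, Nat.mul_le_mul_left _ hall⟩
  · rintro j hj s' f1 f2 - ⟨⟨i1, i2, i3⟩, i4, i5⟩
    simp only [Store.setReg_reg_of_ne _ (show 12 ≠ 13 by norm_num), Store.setReg_arr]
    have h' : Holds G t s' := h.of_eq
      (fun r hr => f1 r (by simp [smallestClass, dropColor]; omega))
      fun a ha => f2 a (by simp [smallestClass, dropColor]; omega)
    have e9 : s'.reg 9 = s₀.reg 9 := f1 9 (by simp [smallestClass, dropColor])
    rw [run_ite]
    simp only [Expr.eval, ite_one_zero_ne_zero, e9]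
    split_ifs with hlt
    · obtain ⟨m1, m2, m3⟩ := smallestClass_run h' (by omega) i2
      simp only [run_seq, run_set, Expr.eval, Store.setReg_reg_self, Store.setReg_arr]
      set s₁ := smallestClass.run s'
      have g12 : s₁.reg 12 = s'.reg 12 := run_reg (by simp [smallestClass]) s'
      have g2 : s₁.arr 2 = s'.arr 2 := run_arr (by simp [smallestClass]) s'
      have h1 : Holds G t s₁ := h'.run (by simp [smallestClass]) (by simp [smallestClass])
        (by simp [smallestClass])
      rw [run_reg (p := dropColor) (r := 12) (by simp [dropColor]), g12]
      have hdrop : ∀ e ∈ E(G), (dropColor.run s₁).arr 2 e =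
          Graph.dropColor (s'.arr 2) (s'.reg 12) (s₁.reg 14) e := fun e he => by
        rw [dropColor_run (h1.mem_edgeSet.1 he), g12, g2]
      generalize s'.reg 12 = K at *
      obtain ⟨k, rfl⟩ : ∃ k, K = k + 1 := Nat.exists_eq_succ_of_ne_zero (by omega)
      rw [Nat.add_sub_cancel]
      exact ⟨⟨by omega, by omega, by omega⟩, (i4.dropColor m2).congr hdrop,
        (i4.mul_le_dropColor hE (by omega) m3 i5).trans_eq (by rw [Graph.coloredCard_congr hdrop])⟩
    · exact ⟨⟨i1, i2, Or.inr (by simp only [run_skip]; omega)⟩, i4, i5⟩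

/-- The whole algorithm. -/
def subgraphColoring : Cmd := seq colorAll (seq maxDegree reduceColors)

theorem subgraphColoring_wf : subgraphColoring.Wf :=
  ⟨colorAll_wf, by simp [maxDegree], by simp [reduceColors, smallestClass, dropColor]⟩

theorem subgraphColoring_run {t : ℤ} (hG : IsInstance G t) (h : Holds G t.toNat s)
    (h0 : s.arr 2 = fun _ => 0) :
    G.IsPartialColoring G.maxDegree ((subgraphColoring.run s).arr 2) ∧
      G.maxDegree * E(G).ncard ≤ t.toNat * G.coloredCard ((subgraphColoring.run s).arr 2) := by
  have hle := hG.nonneg_and_four_mul_le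
  obtain ⟨c1, c2⟩ := colorAll_run h hG.isSparse (h0 ▸ Graph.isPartialColoring_zero)
  have h1 : Holds G t.toNat (colorAll.run s) := h.run colorAll_wf
    (fun hw => by have := colorAll_body_writesArr hw; omega)
    (fun hw => by have := colorAll_body_writesArr hw; omega)
  have hΔ := maxDegree_run h1 hG
  have h2 : Holds G t.toNat (maxDegree.run (colorAll.run s)) :=
    h1.run (by simp [maxDegree]) (by simp [maxDegree]) (by simp [maxDegree])
  have e2 : (maxDegree.run (colorAll.run s)).arr 2 = (colorAll.run s).arr 2 :=
    run_arr (by simp [maxDegree]) _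
  have := reduceColors_run h2 hG.finite_edgeSet (by omega) (by rwa [e2]) (by rwa [e2])
  rwa [hΔ] at this

theorem _root_.Polynomial.eval_mono_nat (p : Polynomial ℕ) {a b : ℕ} (h : a ≤ b) : p.eval a ≤ p.eval b := by
  rw [Polynomial.eval_eq_sum, Polynomial.eval_eq_sum]
  exact Finset.sum_le_sum fun i _ => Nat.mul_le_mul_left _ (Nat.pow_le_pow_left h i)

theorem holds_input {n m t : ℕ} {a b : ℕ → ℕ} (hV : V(G) = {x | x < n}) (hE : E(G) = {e | e < m})
    (hl : ∀ e < m, G.IsLink e (a e) (b e)) : Holds G t (input n m a b t) where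
  vertexSet := hV
  edgeSet := hE
  isLink e he := by
    replace he : e < m := he
    simpa [input, he] using hl e he
  reg_two := rfl

end RAM

theorem theorem2 :
    (∀ (α : Type u) (β : Type v) (G : Graph α β) (t : ℤ), IsInstance G t →
      ∃ H : Graph α β, H ≤ G ∧ H.EdgeColorable G.maxDegree ∧
        (G.maxDegree : ℝ) / (t : ℝ) * (E(G).ncard : ℝ) ≤ (E(H).ncard : ℝ)) ∧
    (∃ (p : RAM.Prog) (P : Polynomial ℕ),
      ∀ (n m : ℕ) (a b : ℕ → ℕ) (G : Graph ℕ ℕ) (t : ℤ),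
        V(G) = {x | x < n} → E(G) = {e | e < m} → (∀ e < m, G.IsLink e (a e) (b e)) →
        IsInstance G t →
        ∃ (T : ℕ) (s : RAM.Store),
          p.Runs (RAM.input n m a b t.toNat) T s ∧ T ≤ P.eval (n + m) ∧
          (G.restrict {e | s.output e ≠ 0}).IsEdgeColoring G.maxDegree s.output ∧
          (G.maxDegree : ℝ) / (t : ℝ) * (E(G).ncard : ℝ) ≤
            (E(G.restrict {e | s.output e ≠ 0}).ncard : ℝ)) := by
  -- The program's time bound is a polynomial in `n + m + t`. Since `t ≤ 2 m`, this sum is at most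
  -- `3 (n + m)`, hence the composition with `3 X`.
  refine ⟨fun α β G t h => h.exists_edgeColorable_subgraph, RAM.subgraphColoring.toProg,
    RAM.subgraphColoring.time.comp (.C 3 * .X), fun n m a b G t hV hE hl hG => ?_⟩
  have h := RAM.holds_input (t := t.toNat) hV hE hl
  obtain ⟨T, hT, hTt⟩ := RAM.subgraphColoring_wf.runs (RAM.input n m a b t.toNat)
  obtain ⟨hc, hcard⟩ := RAM.subgraphColoring_run hG h (by funext e; simp [RAM.input])
  refine ⟨T, _, hT, hTt.trans ?_, hc.isEdgeColoring,
    Graph.div_mul_le_ncard_restrict hG.nonneg_and_four_mul_le.1 hcard⟩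
  rw [Polynomial.eval_comp]
  have ht := hG.toNat_le
  rw [h.ncard_edgeSet] at ht
  refine Polynomial.eval_mono_nat _ ?_
  simp only [RAM.input, Polynomial.eval_mul, Polynomial.eval_C, Polynomial.eval_X] at ht ⊢
  norm_num at ht ⊢
  omega
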